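/- Multidimensional Lauricella identity. Let $(\Omega,\mathcal F)$ be a measurable space, let $\alpha$ be a finite measure on it with $a:=\alpha(\Omega)>0$, and let $\tilde m$ be a Dirichlet process on $(\Omega,\mathcal F)$ with parameter $\alpha$, that is, a random probability measure such that for every finite measurable partition $C_1,\dots,C_{n+1}$ of $\Omega$ the vector $(\tilde m(C_1),\dots,\tilde m(C_n))$ has the Dirichlet distribution with parameter $(\alpha(C_1),\dots,\alpha(C_{n+1}))$ (a zero parameter meaning, as usual, that the corresponding component is a.s. zero). Let $f_1,\dots,f_d:\Omega\to\mathbb R$ be measurable functions such that $$\int_\Omega \log(1+|f_k|)\,d\alpha<+\infty,\qquad k=1,\dots,d.$$ Then, almost surely, every $f_k$ is $\tilde m$-integrable. Denote by $\mu_{\alpha,\mathbf f}$ the probability distribution on $\mathbb R^d$ of the vector of means $\left(\int f_1\,d\tilde m,\dots,\int f_d\,d\tilde m\right)$, and write $\langle\mathbf t,\mathbf f\rangle=\sum_{j=1}^d t_jf_j$. All powers and logarithms below are principal determinations. For every $\mathbf t\in\mathbb R^d$: (i) if $a\ge c>0$, $$\int_{\mathbb R^d}\frac{1}{(1+i\langle\mathbf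 t,\mathbf x\rangle)^c}\,\mu_{\alpha,\mathbf f}(d\mathbf x)=\int_{[0,1]}\exp\left\{-\int_\Omega\log(1+iu\langle\mathbf t,\mathbf f\rangle)\,d\alpha\right\}B(du;c,a-c),$$ where $B(\cdot\,;c,a-c)$ is the Beta distribution with parameters $(c,a-c)$ if $a>c$, and the unit mass at $1$ if $a=c$; (ii) if $c>a>0$, $$\int_{\mathbb R^d}\frac{1}{(1+i\langle\mathbf t,\mathbf x\rangle)^c}\,\mu_{\alpha,\mathbf f}(d\mathbf x)=\frac{\Gamma(c-a+1)\Gamma(a)}{2\pi i\,\Gamma(c)}\int_0^{(1+)}\exp\left\{-\int_\Omega\log(1+iw\langle\mathbf t,\mathbf f\rangle)\,d\alpha\right\}w^{c-1}(w-1)^{a-c-1}\,dw,$$ where $\int_0^{(1+)}$ is the integral along the loop which starts at $0$, encircles $1$ once counterclockwise and returns to $0$: the straight segment from $0$ to $1+\varepsilon e^{-i(\pi-\eta)}$, the arc $w=1+\varepsilon e^{i\theta}$ with $\theta$ increasing from $-(\pi-\eta)$ to $\pi-\eta$, and the straight segment from $1+\varepsilon e^{i(\pi-\eta)}$ to $0$.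 The identity holds for every choice of $\varepsilon\in(0,1)$ and $\eta\in(0,\pi)$. -/

import Mathlib

open MeasureTheory ProbabilityTheory

noncomputable section

/-- The open solid simplex `{u ∈ ℝⁿ : u₁, …, uₙ > 0 and u₁ + ⋯ + uₙ < 1}`. -/
def openSimplex (n : ℕ) : Set (Fin n → ℝ) :=
  {u | (∀ i, 0 < u i) ∧ ∑ i, u i < 1}

/-- The Dirichlet distribution on `ℝⁿ` with strictly positive parameters `b₁, …, bₙ, bₙ₊₁`:
density `Γ(b₁ + ⋯ + bₙ₊₁) / (Γ(b₁) ⋯ Γ(bₙ₊₁)) · u₁^(b₁-1) ⋯ uₙ^(bₙ-1) · (1 - u₁ - ⋯ - uₙ)^(bₙ₊₁-1)`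
on the open solid simplex, with respect to Lebesgue measure. -/
def dirichletMeasure {n : ℕ} (b : Fin (n + 1) → ℝ) : Measure (Fin n → ℝ) :=
  (volume.restrict (openSimplex n)).withDensity fun u =>
    ENNReal.ofReal
      (Real.Gamma (∑ i, b i) / (∏ i, Real.Gamma (b i)) *
        (∏ i : Fin n, u i ^ (b i.castSucc - 1)) * (1 - ∑ i, u i) ^ (b (Fin.last n) - 1))

/-- `m`, defined on the probability space `(E, P)`, is a Dirichlet process on `Ω` with parameter the
finite measure `α`: it is a random probability measure on `Ω` such that, for every finite measurable
partition `C₁, …, Cₙ₊₁` of `Ω`, the vector `(m(C₁), …, m(Cₙ))` has the Dirichlet distribution with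
parameter `(α(C₁), …, α(Cₙ₊₁))`. As usual, a parameter `α(Cᵢ) = 0` means that the corresponding
component is almost surely `0` and that the remaining ones follow the Dirichlet distribution with
the remaining (strictly positive) parameters; so partitions into sets of positive `α`-measure
together with `α`-null sets describe all partitions. -/
structure IsDirichletProcess {Ω E : Type*} [MeasurableSpace Ω] [MeasurableSpace E]
    (α : Measure Ω) (P : Measure E) (m : E → ProbabilityMeasure Ω) : Prop where
  measurable : Measurable m
  map_eq : ∀ (n : ℕ) (C : Fin (n + 1) → Set Ω), (∀ i, MeasurableSet (C i)) →
    Pairwise (fun i j => Disjoint (C i) (C j)) → (⋃ i, C i) = Set.univ → (∀ i, 0 < α (C i)) →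
    P.map (fun e (i : Fin n) => (m e : Measure Ω).real (C i.castSucc)) =
      dirichletMeasure fun i => α.real (C i)
  ae_null : ∀ C : Set Ω, MeasurableSet C → α C = 0 → ∀ᵐ e ∂P, (m e : Measure Ω) C = 0

/-- The law on `ℝᵈ` of the vector of means `(∫ f₁ dm, …, ∫ f_d dm)` of the random probability
measure `m`. -/
def vectorMeanLaw {Ω E : Type*} [MeasurableSpace Ω] [MeasurableSpace E] (P : Measure E)
    (m : E → ProbabilityMeasure Ω) {d : ℕ} (f : Fin d → Ω → ℝ) : Measure (Fin d → ℝ) :=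
  P.map fun e k => ∫ x, f k x ∂(m e : Measure Ω)

/-- The distribution `B(du; p, q)` on `[0, 1]`, for `p > 0` and `q ≥ 0`: the unit mass at `1` if
`q = 0`, and the Beta distribution with parameters `p, q` if `q > 0`. -/
def betaDist (p q : ℝ) : Measure ℝ :=
  open Classical in if q = 0 then Measure.dirac 1 else betaMeasure p q

/-- `exp {-∫ log (1 + i w g) dα}`, with the principal determination of the logarithm. -/
def expNegLogIntegral {Ω : Type*} [MeasurableSpace Ω] (α : Measure Ω) (g : Ω → ℝ) (w : ℂ) : ℂ :=
  Complex.exp (-∫ x, Complex.log (1 + Complex.I * w * (g x : ℂ)) ∂α)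

/-- The integral of `F` along the straight segment from `0` to `z`. -/
def segmentIntegral (F : ℂ → ℂ) (z : ℂ) : ℂ :=
  ∫ s in (0 : ℝ)..1, F ((s : ℂ) * z) * z

/-- The integral `∫_0^{(1+)} F(w) dw` along the loop which starts at `0`, encircles `1` once
counterclockwise and returns to `0`: the segment from `0` to `G = 1 + ε e^{-i(π - η)}` below the
real axis, the arc `w = 1 + ε e^{iθ}` for `θ` from `-(π - η)` to `π - η`, and the segment from
`G' = 1 + ε e^{i(π - η)}` back to `0` above the real axis. For `0 < ε < 1` and `0 < η < π` the loop
stays in the half-plane `Re w > 0`, apart from its end points, and does not meet `(0, 1]`. -/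
def loopIntegral (ε η : ℝ) (F : ℂ → ℂ) : ℂ :=
  segmentIntegral F (circleMap 1 ε (-(Real.pi - η))) +
    (∫ θ in (-(Real.pi - η))..(Real.pi - η), F (circleMap 1 ε θ) * deriv (circleMap 1 ε) θ) -
    segmentIntegral F (circleMap 1 ε (Real.pi - η))

end

noncomputable section

/-! Put `g = ⟨t, f⟩` and `Y = ∫ g dm`. Everything rests on the Markov–Krein identity `E (1 +
iwY)^(-a) = exp (-∫ log (1 + iwg) dα)` for `Re w > 0`, in which the exponent is the total mass `a`;
the theorem then trades `a` for an arbitrary `c > 0`.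

For a simple integrand the identity is a statement about one Dirichlet vector: `E (∑ pⱼ ζⱼ)^(-∑ bⱼ)
= ∏ ζⱼ^(-bⱼ)` (`integral_dirichletMeasure_cpow`). It comes from computing a product of Gamma
integrals with complex rates `ζⱼ` in the coordinates (total, proportions). Simple functions then
approximate any integrand whose real part is bounded below (`IsDirichletProcess.integral_cpow`), and
a rotation brings `1 + iwg` into that form. Applied to truncations of `1 + s|g|`, the same identity
yields almost sure integrability on letting `s → 0`.

If `c ≤ a`, then `(1 + z)^(-c)` is a Beta mixture of `(1 + uz)^(-a)`, and Fubini concludes. If `c >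
a`, the mixture becomes a loop integral with weight `w^(c-1) (w-1)^(a-c-1)`. An exact derivative
shows that this integral, with `X` scaled by `τ`, solves the linear equation of `(1 + iτX)^(-c)`, so
it is a multiple of `(1 + iX)^(-c)` (`IsLoop.loopIntegral_cpow_mul`). The factor, found at `X = 0`,
is a Beta integral along the loop (`IsLoop.loopIntegral_cpow`): a primitive gives it for exponents
in `(0, 1)`, continuity at `0`, and a recursion below `0`. -/

/-! ### Gamma integrals with a complex rate. -/

theorem integrableOn_rpow_mul_exp_neg_mul_Ioi {a r : ℝ} (ha : 0 < a) (hr : 0 < r) :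
    IntegrableOn (fun t : ℝ => t ^ (a - 1) * Real.exp (-(r * t))) (Set.Ioi 0) := by
  have h := integrableOn_rpow_mul_exp_neg_mul_rpow (p := 1) (s := a - 1) (b := r) (by linarith)
    one_pos hr
  refine h.congr_fun (fun t ht => ?_) measurableSet_Ioi
  simp

theorem norm_rpow_mul_cexp_neg_mul {t : ℝ} (ht : 0 < t) (b : ℝ) (r : ℂ) :
    ‖((t ^ b : ℝ) : ℂ) * Complex.exp (-(r * t))‖ = t ^ b * Real.exp (-(r.re * t)) := by
  rw [norm_mul, Complex.norm_real, Real.norm_of_nonneg (Real.rpow_nonneg ht.le _),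
    Complex.norm_exp]
  simp

theorem integrableOn_rpow_mul_cexp_neg_mul_Ioi {a : ℝ} {r : ℂ} (ha : 0 < a) (hr : 0 < r.re) :
    IntegrableOn (fun t : ℝ => ((t ^ (a - 1) : ℝ) : ℂ) * Complex.exp (-(r * t))) (Set.Ioi 0) := by
  refine Integrable.mono' (integrableOn_rpow_mul_exp_neg_mul_Ioi ha hr)
    (Measurable.aestronglyMeasurable (by fun_prop)) ?_
  refine ae_restrict_of_forall_mem measurableSet_Ioi fun t ht => ?_
  rw [norm_rpow_mul_cexp_neg_mul ht]

/-- The Gamma integral with a complex rate. -/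
theorem integral_rpow_mul_cexp_neg_mul_Ioi {a : ℝ} {r : ℂ} (ha : 0 < a) (hr : 0 < r.re) :
    ∫ t in Set.Ioi (0 : ℝ), ((t ^ (a - 1) : ℝ) : ℂ) * Complex.exp (-(r * t)) =
      Real.Gamma a * r ^ (-(a : ℂ)) := by
  -- As a function of the rate, the integral is a complex moment generating function, hence analytic
  -- on the right half-plane. The identity theorem then extends the formula from positive real
  -- rates.
  set μ : Measure ℝ :=
    (volume.restrict (Set.Ioi 0)).withDensity (fun t => ENNReal.ofReal (t ^ (a - 1))) with hμ
  have hmeas : Measurable fun t : ℝ => ENNReal.ofReal (t ^ (a - 1)) := by fun_prop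
  have hmgf : ∀ z : ℂ, complexMGF id μ (-z) =
      ∫ t in Set.Ioi (0 : ℝ), ((t ^ (a - 1) : ℝ) : ℂ) * Complex.exp (-(z * t)) := by
    intro z
    rw [complexMGF, hμ, integral_withDensity_eq_integral_toReal_smul hmeas (by simp)]
    refine setIntegral_congr_fun measurableSet_Ioi fun t ht => ?_
    simp only [id]
    rw [ENNReal.toReal_ofReal (Real.rpow_nonneg (le_of_lt ht) _), Complex.real_smul, neg_mul]
  have hsub : Set.Iio (0 : ℝ) ⊆ integrableExpSet id μ := by
    intro s hs
    have hs' : s < 0 := hs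
    rw [integrableExpSet, Set.mem_ofPred_eq, hμ,
      integrable_withDensity_iff_integrable_smul' hmeas (by simp)]
    refine (integrableOn_rpow_mul_exp_neg_mul_Ioi ha (neg_pos.2 hs')).congr_fun
      (fun t ht => ?_) measurableSet_Ioi
    simp only [id]
    rw [ENNReal.toReal_ofReal (Real.rpow_nonneg (le_of_lt ht) _), smul_eq_mul]
    ring_nf
  have hopen : IsOpen {z : ℂ | 0 < z.re} := isOpen_lt continuous_const Complex.continuous_re
  have hf : AnalyticOnNhd ℂ (fun z => complexMGF id μ (-z)) {z : ℂ | 0 < z.re} := by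
    refine DifferentiableOn.analyticOnNhd (fun z hz => ?_) hopen
    refine DifferentiableAt.differentiableWithinAt ?_
    have : DifferentiableAt ℂ (complexMGF id μ) (-z) := by
      refine (hasDerivAt_complexMGF (interior_mono hsub ?_)).differentiableAt
      rw [interior_Iio]
      simpa using hz
    exact this.comp z differentiableAt_fun_id.neg
  have hg : AnalyticOnNhd ℂ (fun z : ℂ => (Real.Gamma a : ℂ) * z ^ (-(a : ℂ))) {z : ℂ | 0 < z.re} := by
    refine DifferentiableOn.analyticOnNhd (fun z hz => ?_) hopen
    refine DifferentiableAt.differentiableWithinAt ?_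
    exact (differentiableAt_id.cpow_const (Or.inl hz)).const_mul _
  have hpre : IsPreconnected {z : ℂ | 0 < z.re} := (convex_halfSpace_re_gt 0).isPreconnected
  have hreal : ∀ x : ℝ, 0 < x → complexMGF id μ (-(x : ℂ)) = Real.Gamma a * (x : ℂ) ^ (-(a : ℂ)) := by
    intro x hx
    rw [hmgf]
    have h := Real.integral_rpow_mul_exp_neg_mul_Ioi ha hx
    have h2 : ∫ t in Set.Ioi (0 : ℝ), ((t ^ (a - 1) : ℝ) : ℂ) * Complex.exp (-((x : ℂ) * t)) =
        ((∫ t in Set.Ioi (0 : ℝ), t ^ (a - 1) * Real.exp (-(x * t)) : ℝ) : ℂ) := by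
      rw [← integral_complex_ofReal]
      refine integral_congr_ae (Filter.Eventually.of_forall fun t => ?_)
      push_cast
      rfl
    rw [h2, h, one_div, Real.inv_rpow hx.le, ← Real.rpow_neg hx.le]
    push_cast
    rw [Complex.ofReal_cpow hx.le]
    push_cast
    ring
  have hfreq : ∃ᶠ z in nhdsWithin (1 : ℂ) {1}ᶜ,
      complexMGF id μ (-z) = (Real.Gamma a : ℂ) * z ^ (-(a : ℂ)) := by
    have ht : Filter.Tendsto (fun x : ℝ => (x : ℂ)) (nhdsWithin 1 (Set.Ioi 1))
        (nhdsWithin (1 : ℂ) {1}ᶜ) := by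
      refine tendsto_nhdsWithin_iff.2 ⟨?_, ?_⟩
      · have := (Complex.continuous_ofReal.tendsto (1 : ℝ))
        rw [Complex.ofReal_one] at this
        exact this.mono_left nhdsWithin_le_nhds
      · filter_upwards [self_mem_nhdsWithin] with x hx
        have hx' : (1 : ℝ) < x := hx
        simp only [Set.mem_compl_iff, Set.mem_singleton_iff]
        exact_mod_cast hx'.ne'
    refine ht.frequently (Filter.Eventually.frequently ?_)
    filter_upwards [self_mem_nhdsWithin] with x hx
    exact hreal x (lt_trans one_pos hx)
  have := hf.eqOn_of_preconnected_of_frequently_eq hg hpre (z₀ := 1) (by simp) hfreq hr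
  rw [← hmgf]
  exact this

/-! ### The Dirichlet identity from independent Gamma factors. -/

/-- The unnormalised Gamma kernel with shape `b` and complex rate `ζ`. -/
def gammaKernel (b : ℝ) (ζ : ℂ) (y : ℝ) : ℂ :=
  (Set.Ioi (0 : ℝ)).indicator (fun y : ℝ => ((y ^ (b - 1) : ℝ) : ℂ) * Complex.exp (-(ζ * y))) y

theorem measurable_gammaKernel (b : ℝ) (ζ : ℂ) : Measurable (gammaKernel b ζ) :=
  Measurable.indicator (by fun_prop) measurableSet_Ioi

theorem integrable_gammaKernel {b : ℝ} {ζ : ℂ} (hb : 0 < b) (hζ : 0 < ζ.re) :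
    Integrable (gammaKernel b ζ) :=
  (integrableOn_rpow_mul_cexp_neg_mul_Ioi hb hζ).integrable_indicator measurableSet_Ioi

theorem integral_gammaKernel {b : ℝ} {ζ : ℂ} (hb : 0 < b) (hζ : 0 < ζ.re) :
    ∫ y, gammaKernel b ζ y = Real.Gamma b * ζ ^ (-(b : ℂ)) := by
  rw [← integral_rpow_mul_cexp_neg_mul_Ioi hb hζ, ← integral_indicator measurableSet_Ioi]
  rfl

theorem gammaKernel_of_pos {b : ℝ} {ζ : ℂ} {y : ℝ} (hy : 0 < y) :
    gammaKernel b ζ y = ((y ^ (b - 1) : ℝ) : ℂ) * Complex.exp (-(ζ * y)) :=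
  Set.indicator_of_mem (Set.mem_Ioi.2 hy) _

theorem gammaKernel_of_nonpos {b : ℝ} {ζ : ℂ} {y : ℝ} (hy : y ≤ 0) : gammaKernel b ζ y = 0 :=
  Set.indicator_of_notMem (by simpa using hy) _

theorem gammaKernel_mul {b r y : ℝ} {ζ : ℂ} (hr : 0 < r) (hy : 0 < y) :
    gammaKernel b ζ (r * y) = ((r ^ (b - 1) : ℝ) : ℂ) *
      (((y ^ (b - 1) : ℝ) : ℂ) * Complex.exp (-(ζ * (r * y)))) := by
  rw [gammaKernel_of_pos (mul_pos hr hy), Real.mul_rpow hr.le hy.le]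
  push_cast
  ring

/-- The product of Gamma kernels on `ℝⁿ⁺¹`, parametrised by the first `n` coordinates and the
total. -/
def gammaProd {n : ℕ} (b : Fin (n + 1) → ℝ) (ζ : Fin (n + 1) → ℂ) (r : ℝ) (u : Fin n → ℝ) : ℂ :=
  gammaKernel (b (Fin.last n)) (ζ (Fin.last n)) (r - ∑ i, u i) *
    ∏ i : Fin n, gammaKernel (b i.castSucc) (ζ i.castSucc) (u i)

theorem measurable_gammaProd {n : ℕ} (b : Fin (n + 1) → ℝ) (ζ : Fin (n + 1) → ℂ) :
    Measurable (Function.uncurry (gammaProd b ζ)) := by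
  unfold gammaProd
  refine Measurable.mul ((measurable_gammaKernel _ _).comp (by fun_prop)) ?_
  exact Finset.measurable_prod _ fun i _ =>
    (measurable_gammaKernel _ _).comp ((measurable_pi_apply i).comp measurable_snd)

/-- A shear: for fixed `u` it is a translation of the other coordinate. The two swaps bring it to
the shape of `MeasurePreserving.skew_product`. -/
theorem measurePreserving_sub_sum (n : ℕ) :
    MeasurePreserving (fun p : ℝ × (Fin n → ℝ) => (p.1 - ∑ i, p.2 i, p.2))
      (volume : Measure (ℝ × (Fin n → ℝ))) volume := by
  have h := MeasurePreserving.skew_product (μa := (volume : Measure (Fin n → ℝ)))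
    (μc := (volume : Measure ℝ)) (μd := (volume : Measure ℝ)) (MeasurePreserving.id _)
    (g := fun u r => r - ∑ i, u i) (by unfold Function.uncurry; fun_prop)
    (Filter.Eventually.of_forall fun u => (measurePreserving_sub_right volume (∑ i, u i)).map_eq)
  exact (Measure.measurePreserving_swap.comp h).comp Measure.measurePreserving_swap

theorem measurePreserving_snoc (n : ℕ) :
    MeasurePreserving (MeasurableEquiv.piFinSuccAbove (fun _ : Fin (n + 1) => ℝ) (Fin.last n)).symm
      (volume : Measure (ℝ × (Fin n → ℝ))) volume :=
  (volume_preserving_piFinSuccAbove (fun _ : Fin (n + 1) => ℝ) (Fin.last n)).symm _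

/-- Exhibits the kernel as a plain product of one-variable kernels after two volume-preserving maps,
so that integrability and integral reduce to dimension one. -/
theorem gammaProd_eq {n : ℕ} (b : Fin (n + 1) → ℝ) (ζ : Fin (n + 1) → ℂ) :
    Function.uncurry (gammaProd b ζ) =
      ((fun y : Fin (n + 1) → ℝ => ∏ j, gammaKernel (b j) (ζ j) (y j)) ∘
        (MeasurableEquiv.piFinSuccAbove (fun _ : Fin (n + 1) => ℝ) (Fin.last n)).symm) ∘
        fun p : ℝ × (Fin n → ℝ) => (p.1 - ∑ i, p.2 i, p.2) := by
  ext ⟨r, u⟩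
  simp [gammaProd, Fin.prod_univ_castSucc, MeasurableEquiv.piFinSuccAbove, Function.uncurry,
    mul_comm]

theorem integrable_gammaProd {n : ℕ} {b : Fin (n + 1) → ℝ} {ζ : Fin (n + 1) → ℂ}
    (hb : ∀ j, 0 < b j) (hζ : ∀ j, 0 < (ζ j).re) :
    Integrable (Function.uncurry (gammaProd b ζ)) := by
  rw [gammaProd_eq]
  refine (measurePreserving_sub_sum n).integrable_comp_of_integrable ?_
  refine (measurePreserving_snoc n).integrable_comp_of_integrable ?_
  exact Integrable.fintype_prod fun j => integrable_gammaKernel (hb j) (hζ j)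

theorem integral_gammaProd {n : ℕ} {b : Fin (n + 1) → ℝ} {ζ : Fin (n + 1) → ℂ}
    (hb : ∀ j, 0 < b j) (hζ : ∀ j, 0 < (ζ j).re) :
    ∫ r, ∫ u, gammaProd b ζ r u = ∏ j, (Real.Gamma (b j) * ζ j ^ (-(b j : ℂ))) := by
  have h1 : ∫ p, Function.uncurry (gammaProd b ζ) p =
      ∫ r, ∫ u, gammaProd b ζ r u := integral_prod _ (integrable_gammaProd hb hζ)
  set Φ : ℝ × (Fin n → ℝ) → ℂ := (fun y : Fin (n + 1) → ℝ => ∏ j, gammaKernel (b j) (ζ j) (y j)) ∘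
    (MeasurableEquiv.piFinSuccAbove (fun _ : Fin (n + 1) => ℝ) (Fin.last n)).symm with hΦ
  have hm : Measurable Φ :=
    (Finset.measurable_prod _ fun j _ =>
      (measurable_gammaKernel _ _).comp (measurable_pi_apply j)).comp (MeasurableEquiv.measurable _)
  rw [← h1, gammaProd_eq]
  have h2 := integral_map (measurePreserving_sub_sum n).aemeasurable (hm.aestronglyMeasurable)
  rw [(measurePreserving_sub_sum n).map_eq] at h2
  refine h2.symm.trans ?_
  refine ((measurePreserving_snoc n).integral_comp'
    (fun y : Fin (n + 1) → ℝ => ∏ j, gammaKernel (b j) (ζ j) (y j))).trans ?_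
  rw [integral_fintype_prod_volume_eq_prod]
  exact Finset.prod_congr rfl fun j _ => integral_gammaKernel (hb j) (hζ j)

/-- The unnormalised Dirichlet density. -/
def dirichletKernel {n : ℕ} (b : Fin (n + 1) → ℝ) (u : Fin n → ℝ) : ℝ :=
  (∏ i : Fin n, u i ^ (b i.castSucc - 1)) * (1 - ∑ i, u i) ^ (b (Fin.last n) - 1)

theorem measurable_dirichletKernel {n : ℕ} (b : Fin (n + 1) → ℝ) :
    Measurable (dirichletKernel b) := by
  unfold dirichletKernel
  exact (Finset.measurable_prod _ fun i _ => by fun_prop).mul (by fun_prop)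

theorem measurableSet_openSimplex (n : ℕ) : MeasurableSet (openSimplex n) := by
  have h : openSimplex n = (⋂ i, {u | 0 < u i}) ∩ {u | ∑ i, u i < 1} := by
    ext u
    simp [openSimplex]
  rw [h]
  refine MeasurableSet.inter (MeasurableSet.iInter fun i => ?_) ?_
  · exact measurableSet_lt measurable_const (measurable_pi_apply i)
  · exact measurableSet_lt (Finset.measurable_sum _ fun i _ => measurable_pi_apply i)
      measurable_const

/-- The value `∑ pⱼ ζⱼ` of the mean at the point `(u, 1 - ∑ uᵢ)` of the simplex. -/
def simplexMean {n : ℕ} (ζ : Fin (n + 1) → ℂ) (u : Fin n → ℝ) : ℂ :=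
  ∑ i : Fin n, (u i : ℂ) * ζ i.castSucc + ((1 - ∑ i, u i : ℝ) : ℂ) * ζ (Fin.last n)

theorem measurable_simplexMean {n : ℕ} (ζ : Fin (n + 1) → ℂ) : Measurable (simplexMean ζ) := by
  unfold simplexMean
  fun_prop

/-- With total `r` and proportions `u`, the powers of `r` factor out and the exponents add up to `r`
times the mean. Off the simplex some proportion, possibly the last, is nonpositive, and its kernel
vanishes. -/
theorem gammaProd_smul {n : ℕ} (b : Fin (n + 1) → ℝ) (ζ : Fin (n + 1) → ℂ) {r : ℝ} (hr : 0 < r)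
    (u : Fin n → ℝ) :
    gammaProd b ζ r (r • u) = (openSimplex n).indicator (fun u =>
      ((r ^ (∑ j, (b j - 1)) : ℝ) : ℂ) *
        ((dirichletKernel b u : ℂ) * Complex.exp (-(simplexMean ζ u * r)))) u := by
  have hsum : r - ∑ i, (r • u) i = r * (1 - ∑ i, u i) := by
    simp [mul_sub, Finset.mul_sum]
  by_cases hu : u ∈ openSimplex n
  · rw [Set.indicator_of_mem hu, gammaProd, hsum, gammaKernel_mul hr (sub_pos.2 hu.2)]
    have : ∀ i : Fin n, gammaKernel (b i.castSucc) (ζ i.castSucc) ((r • u) i) =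
        ((r ^ (b i.castSucc - 1) : ℝ) : ℂ) * (((u i ^ (b i.castSucc - 1) : ℝ) : ℂ) *
          Complex.exp (-(ζ i.castSucc * (r * u i)))) := fun i => by
      rw [Pi.smul_apply, smul_eq_mul, gammaKernel_mul hr (hu.1 i)]
    simp only [this, Finset.prod_mul_distrib]
    rw [Fin.sum_univ_castSucc, Real.rpow_add hr, Real.rpow_sum_of_pos hr, dirichletKernel, simplexMean,
      ← Complex.exp_sum]
    have hexp : -((∑ i : Fin n, (u i : ℂ) * ζ i.castSucc +
        ((1 - ∑ i, u i : ℝ) : ℂ) * ζ (Fin.last n)) * r) =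
        ∑ i : Fin n, -(ζ i.castSucc * (r * u i)) +
          -(ζ (Fin.last n) * (r * ((1 - ∑ i, u i : ℝ) : ℂ))) := by
      rw [add_mul, Finset.sum_mul, neg_add, Finset.sum_neg_distrib]
      congr 1
      · congr 1
        exact Finset.sum_congr rfl fun i _ => by ring
      · ring
    rw [hexp, Complex.exp_add]
    push_cast
    ring
  · rw [Set.indicator_of_notMem hu, gammaProd]
    by_cases h : ∀ i, 0 < u i
    · have hs : r - ∑ i, (r • u) i ≤ 0 := by
        rw [hsum]
        have : ¬ (∑ i, u i < 1) := fun h' => hu ⟨h, h'⟩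
        exact mul_nonpos_of_nonneg_of_nonpos hr.le (by linarith)
      rw [gammaKernel_of_nonpos hs, zero_mul]
    · push Not at h
      obtain ⟨i, hi⟩ := h
      rw [Finset.prod_eq_zero (Finset.mem_univ i), mul_zero]
      exact gammaKernel_of_nonpos (mul_nonpos_of_nonneg_of_nonpos hr.le hi)

theorem gammaProd_of_nonpos {n : ℕ} (b : Fin (n + 1) → ℝ) (ζ : Fin (n + 1) → ℂ) {r : ℝ}
    (hr : r ≤ 0) (u : Fin n → ℝ) : gammaProd b ζ r u = 0 := by
  rw [gammaProd]
  by_cases h : ∀ i, 0 < u i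
  · have : 0 ≤ ∑ i, u i := Finset.sum_nonneg fun i _ => (h i).le
    rw [gammaKernel_of_nonpos (by linarith), zero_mul]
  · push Not at h
    obtain ⟨i, hi⟩ := h
    rw [Finset.prod_eq_zero (Finset.mem_univ i), mul_zero]
    exact gammaKernel_of_nonpos hi

theorem dirichletKernel_nonneg {n : ℕ} (b : Fin (n + 1) → ℝ) {u : Fin n → ℝ}
    (hu : u ∈ openSimplex n) : 0 ≤ dirichletKernel b u :=
  mul_nonneg (Finset.prod_nonneg fun i _ => Real.rpow_nonneg (hu.1 i).le _)
    (Real.rpow_nonneg (sub_nonneg.2 hu.2.le) _)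

theorem le_re_simplexMean {n : ℕ} {ζ : Fin (n + 1) → ℂ} {δ : ℝ} (hζ : ∀ j, δ ≤ (ζ j).re)
    {u : Fin n → ℝ} (hu : u ∈ openSimplex n) : δ ≤ (simplexMean ζ u).re := by
  have h1 : (simplexMean ζ u).re =
      ∑ i : Fin n, u i * (ζ i.castSucc).re + (1 - ∑ i, u i) * (ζ (Fin.last n)).re := by
    simp [simplexMean]
  have h2 : ∑ i : Fin n, u i * δ ≤ ∑ i : Fin n, u i * (ζ i.castSucc).re :=
    Finset.sum_le_sum fun i _ => mul_le_mul_of_nonneg_left (hζ _) (hu.1 i).le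
  have h3 := mul_le_mul_of_nonneg_left (hζ (Fin.last n)) (sub_nonneg.2 hu.2.le)
  rw [← Finset.sum_mul] at h2
  rw [h1]
  linarith

/-- The integrand `r^(a-1) D(u) e^{-r S(u)}` on `(0, ∞) × openSimplex n`, where `D` is the Dirichlet
kernel and `S` the mean. -/
def radialKernel {n : ℕ} (b : Fin (n + 1) → ℝ) (ζ : Fin (n + 1) → ℂ) (r : ℝ) (u : Fin n → ℝ) : ℂ :=
  (openSimplex n).indicator (fun u => (dirichletKernel b u : ℂ) *
    gammaKernel (∑ j, b j) (simplexMean ζ u) r) u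

theorem measurable_radialKernel {n : ℕ} (b : Fin (n + 1) → ℝ) (ζ : Fin (n + 1) → ℂ) :
    Measurable (Function.uncurry (radialKernel b ζ)) := by
  have h : Function.uncurry (radialKernel b ζ) = (Set.Ioi (0 : ℝ) ×ˢ openSimplex n).indicator
      fun p => (dirichletKernel b p.2 : ℂ) *
        (((p.1 ^ (∑ j, b j - 1) : ℝ) : ℂ) * Complex.exp (-(simplexMean ζ p.2 * p.1))) := by
    ext ⟨r, u⟩
    by_cases hr : 0 < r <;> by_cases hu : u ∈ openSimplex n <;>
      simp [radialKernel, gammaKernel, Set.indicator, hr, hu]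
  rw [h]
  refine Measurable.indicator ?_ (measurableSet_Ioi.prod (measurableSet_openSimplex n))
  have h1 := measurable_dirichletKernel b
  have h2 := measurable_simplexMean ζ
  fun_prop

/-- The factor `r ^ n` is the Jacobian of `u ↦ r • u`; it raises the exponent `∑ bⱼ - (n + 1)` to `∑
bⱼ - 1`, the one of a Gamma kernel in `r`. -/
theorem radialKernel_eq {n : ℕ} (b : Fin (n + 1) → ℝ) (ζ : Fin (n + 1) → ℂ) {r : ℝ} (hr : 0 < r)
    (u : Fin n → ℝ) : radialKernel b ζ r u = (r ^ n) • gammaProd b ζ r (r • u) := by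
  rw [gammaProd_smul b ζ hr, radialKernel]
  by_cases hu : u ∈ openSimplex n
  · rw [Set.indicator_of_mem hu, Set.indicator_of_mem hu, gammaKernel_of_pos hr, Complex.real_smul]
    have : r ^ (∑ j, b j - 1) = r ^ n * r ^ (∑ j, (b j - 1)) := by
      rw [← Real.rpow_natCast, ← Real.rpow_add hr]
      congr 1
      simp
      ring
    rw [this]
    push_cast
    ring
  · rw [Set.indicator_of_notMem hu, Set.indicator_of_notMem hu, smul_zero]

theorem radialKernel_of_nonpos {n : ℕ} (b : Fin (n + 1) → ℝ) (ζ : Fin (n + 1) → ℂ) {r : ℝ}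
    (hr : r ≤ 0) (u : Fin n → ℝ) : radialKernel b ζ r u = 0 := by
  rw [radialKernel]
  refine Set.indicator_apply_eq_zero.2 fun _ => ?_
  rw [gammaKernel_of_nonpos hr, mul_zero]

theorem integral_comp_radial {F : Type*} [NormedAddCommGroup F] [NormedSpace ℝ F] {n : ℕ}
    (f : (Fin n → ℝ) → F) {r : ℝ} (hr : 0 < r) :
    ∫ u, r ^ n • f (r • u) = ∫ u, f u := by
  rw [integral_smul, Measure.integral_comp_smul_of_nonneg volume f r (hR := hr.le),
    Module.finrank_fin_fun, smul_inv_smul₀ (by positivity)]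

theorem integral_radialKernel_right {n : ℕ} (b : Fin (n + 1) → ℝ) (ζ : Fin (n + 1) → ℂ) (r : ℝ) :
    ∫ u, radialKernel b ζ r u = ∫ u, gammaProd b ζ r u := by
  rcases le_or_gt r 0 with hr | hr
  · simp [radialKernel_of_nonpos b ζ hr, gammaProd_of_nonpos b ζ hr]
  · simp only [radialKernel_eq b ζ hr]
    exact integral_comp_radial _ hr

theorem integral_norm_radialKernel_right {n : ℕ} (b : Fin (n + 1) → ℝ) (ζ : Fin (n + 1) → ℂ)
    (r : ℝ) : ∫ u, ‖radialKernel b ζ r u‖ = ∫ u, ‖gammaProd b ζ r u‖ := by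
  rcases le_or_gt r 0 with hr | hr
  · simp [radialKernel_of_nonpos b ζ hr, gammaProd_of_nonpos b ζ hr]
  · simp only [radialKernel_eq b ζ hr, norm_smul, norm_pow, Real.norm_of_nonneg hr.le]
    exact integral_comp_radial (fun u => ‖gammaProd b ζ r u‖) hr

/-- For each `r` the fibres of both kernels have the same `L¹` norm, so Tonelli's criterion passes
from one to the other with no change of variables on the product. -/
theorem integrable_radialKernel {n : ℕ} {b : Fin (n + 1) → ℝ} {ζ : Fin (n + 1) → ℂ}
    (hb : ∀ j, 0 < b j) (hζ : ∀ j, 0 < (ζ j).re) :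
    Integrable (Function.uncurry (radialKernel b ζ)) := by
  have h := (integrable_prod_iff (measurable_gammaProd b ζ).aestronglyMeasurable).1
    (integrable_gammaProd hb hζ)
  refine (integrable_prod_iff (measurable_radialKernel b ζ).aestronglyMeasurable).2 ⟨?_, ?_⟩
  · filter_upwards [h.1] with r hr
    rcases le_or_gt r 0 with hr0 | hr0
    · simp [Function.uncurry, radialKernel_of_nonpos b ζ hr0]
    · simp only [Function.uncurry, radialKernel_eq b ζ hr0]
      exact ((integrable_comp_smul_iff volume (gammaProd b ζ r) hr0.ne').2 hr).smul (r ^ n)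
  · have h2 := h.2
    simp only [Function.uncurry, integral_norm_radialKernel_right] at h2 ⊢
    exact h2

/-- The radial kernel is integrated in both orders: `u` first leads to the product of Gamma
integrals, `r` first to a single Gamma integral of shape `∑ bⱼ` whose rate is the mean. -/
theorem integral_simplex_dirichletKernel_mul_cpow {n : ℕ} {b : Fin (n + 1) → ℝ}
    {ζ : Fin (n + 1) → ℂ} (hb : ∀ j, 0 < b j) (hζ : ∀ j, 0 < (ζ j).re) :
    ∫ u in openSimplex n, (dirichletKernel b u : ℂ) *
        (Real.Gamma (∑ j, b j) * simplexMean ζ u ^ (-((∑ j, b j : ℝ) : ℂ))) =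
      ∏ j, (Real.Gamma (b j) * ζ j ^ (-(b j : ℂ))) := by
  rw [← integral_gammaProd hb hζ]
  simp only [← integral_radialKernel_right]
  rw [integral_integral_swap (integrable_radialKernel hb hζ),
    ← integral_indicator (measurableSet_openSimplex n)]
  refine integral_congr_ae (Filter.Eventually.of_forall fun u => ?_)
  by_cases hu : u ∈ openSimplex n
  · have hb' : 0 < ∑ j, b j := Finset.sum_pos (fun j _ => hb j) Finset.univ_nonempty
    obtain ⟨j₀, -, hj₀⟩ := Finset.exists_min_image Finset.univ (fun j => (ζ j).re)
      Finset.univ_nonempty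
    have hS : 0 < (simplexMean ζ u).re :=
      lt_of_lt_of_le (hζ j₀) (le_re_simplexMean (fun j => hj₀ j (Finset.mem_univ j)) hu)
    simp only [radialKernel, Set.indicator_of_mem hu]
    rw [integral_const_mul, integral_gammaKernel hb' hS]
  · simp [radialKernel, Set.indicator_of_notMem hu]

theorem integral_dirichletMeasure {n : ℕ} {b : Fin (n + 1) → ℝ} (hb : ∀ j, 0 < b j)
    (F : (Fin n → ℝ) → ℂ) :
    ∫ u, F u ∂(dirichletMeasure b) = ∫ u in openSimplex n,
      ((Real.Gamma (∑ j, b j) / ∏ j, Real.Gamma (b j) : ℝ) : ℂ) * (dirichletKernel b u * F u) := by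
  have hm : Measurable fun u : Fin n → ℝ => ENNReal.ofReal
      (Real.Gamma (∑ i, b i) / (∏ i, Real.Gamma (b i)) *
        (∏ i : Fin n, u i ^ (b i.castSucc - 1)) * (1 - ∑ i, u i) ^ (b (Fin.last n) - 1)) := by
    have := measurable_dirichletKernel b
    unfold dirichletKernel at this
    simp only [mul_assoc]
    fun_prop
  rw [dirichletMeasure, integral_withDensity_eq_integral_toReal_smul hm (by simp)]
  refine setIntegral_congr_fun (measurableSet_openSimplex n) fun u hu => ?_
  have hb' : 0 < ∑ j, b j := Finset.sum_pos (fun j _ => hb j) Finset.univ_nonempty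
  have h1 : 0 ≤ Real.Gamma (∑ i, b i) / (∏ i, Real.Gamma (b i)) * dirichletKernel b u :=
    mul_nonneg (div_nonneg (Real.Gamma_pos_of_pos hb').le
      (Finset.prod_nonneg fun i _ => (Real.Gamma_pos_of_pos (hb i)).le)) (dirichletKernel_nonneg b hu)
  rw [dirichletKernel, ← mul_assoc] at h1
  rw [ENNReal.toReal_ofReal h1, mul_assoc, ← dirichletKernel, Complex.real_smul, Complex.ofReal_mul,
    mul_assoc]

/-- The mean of a Dirichlet vector: `E (∑ pⱼ ζⱼ)^(-∑ bⱼ) = ∏ ζⱼ^(-bⱼ)`. -/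
theorem integral_dirichletMeasure_cpow {n : ℕ} {b : Fin (n + 1) → ℝ} {ζ : Fin (n + 1) → ℂ}
    (hb : ∀ j, 0 < b j) (hζ : ∀ j, 0 < (ζ j).re) :
    ∫ u, simplexMean ζ u ^ (-((∑ j, b j : ℝ) : ℂ)) ∂(dirichletMeasure b) =
      ∏ j, ζ j ^ (-(b j : ℂ)) := by
  rw [integral_dirichletMeasure hb]
  have hP : (∏ j, (Real.Gamma (b j) : ℂ)) ≠ 0 := Finset.prod_ne_zero_iff.2 fun j _ => by
    exact_mod_cast (Real.Gamma_pos_of_pos (hb j)).ne'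
  have h := integral_simplex_dirichletKernel_mul_cpow hb hζ
  rw [Finset.prod_mul_distrib] at h
  rw [← mul_right_inj' hP, ← h, ← integral_const_mul]
  refine integral_congr_ae (Filter.Eventually.of_forall fun u => ?_)
  simp only [Complex.ofReal_div, Complex.ofReal_prod]
  field_simp

/-! ### Lowering the exponent by a Beta mixture. -/

/-- `(1 + z)^(-c)` is the mean of `(1 + u z)^(-a)` under the distribution `B(du; c, a - c)`. -/
theorem integral_betaDist_cpow {a c : ℝ} (hc : 0 < c) (hca : c ≤ a) {z : ℂ} (hz : 0 < (1 + z).re) :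
    ∫ u, (1 + u * z) ^ (-(a : ℂ)) ∂(betaDist c (a - c)) = (1 + z) ^ (-(c : ℂ)) := by
  rcases hca.eq_or_lt with rfl | hlt
  · have hm : Measurable fun u : ℝ => (1 + (u : ℂ) * z) ^ (-(c : ℂ)) := by fun_prop
    rw [betaDist, if_pos (sub_self c), integral_dirac' _ _ hm.stronglyMeasurable]
    simp
  have hq : 0 < a - c := sub_pos.2 hlt
  -- The Beta law is the Dirichlet law with two parameters. For `ζ = (1 + z, 1)` the mean is `u (1 +
  -- z) + (1 - u) = 1 + u z`, and the second factor of the product of powers is `1`.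
  set b : Fin 2 → ℝ := ![c, a - c] with hb_def
  set ζ : Fin 2 → ℂ := ![1 + z, 1] with hζ_def
  have hb : ∀ j, 0 < b j := by intro j; fin_cases j <;> simp [hb_def, hc, hlt]
  have hζ : ∀ j, 0 < (ζ j).re := by
    intro j
    fin_cases j
    · simpa [hζ_def] using hz
    · simp [hζ_def]
  have h := integral_simplex_dirichletKernel_mul_cpow hb hζ
  have hsum : ∑ j, b j = a := by simp [hb_def]
  have hΓa : Real.Gamma a ≠ 0 := (Real.Gamma_pos_of_pos (hc.trans hlt)).ne'
  have hΓc : Real.Gamma c ≠ 0 := (Real.Gamma_pos_of_pos hc).ne'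
  have hΓq : Real.Gamma (a - c) ≠ 0 := (Real.Gamma_pos_of_pos hq).ne'
  rw [betaDist, if_neg hq.ne', betaMeasure, integral_withDensity_eq_integral_toReal_smul
    (show Measurable (betaPDF c (a - c)) from
      ENNReal.measurable_ofReal.comp (measurable_betaPDFReal _ _)) (by simp [betaPDF])]
  have h1 : ∀ u : ℝ, (betaPDF c (a - c) u).toReal • (1 + (u : ℂ) * z) ^ (-(a : ℂ)) =
      (Set.Ioo (0 : ℝ) 1).indicator (fun u : ℝ =>
        ((Real.Gamma a / (Real.Gamma c * Real.Gamma (a - c)) : ℝ) : ℂ) *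
        (((u ^ (c - 1) * (1 - u) ^ (a - c - 1) : ℝ) : ℂ) * (1 + (u : ℂ) * z) ^ (-(a : ℂ)))) u := by
    intro u
    by_cases hu : 0 < u ∧ u < 1
    · rw [Set.indicator_of_mem (Set.mem_Ioo.2 hu), betaPDF, ENNReal.toReal_ofReal
        (betaPDFReal_pos hu.1 hu.2 hc hq).le, betaPDFReal, if_pos hu, beta, add_sub_cancel,
        Complex.real_smul]
      push_cast
      field_simp
    · rw [Set.indicator_of_notMem (by simpa using hu), betaPDF, betaPDFReal, if_neg hu]
      simp
  simp only [h1]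
  rw [integral_indicator measurableSet_Ioo, integral_const_mul]
  have h2 := ((volume_preserving_funUnique (Fin 1) ℝ).symm _).setIntegral_preimage_emb
    (MeasurableEquiv.measurableEmbedding _) (fun u => (dirichletKernel b u : ℂ) *
        (Real.Gamma (∑ j, b j) * simplexMean ζ u ^ (-((∑ j, b j : ℝ) : ℂ)))) (openSimplex 1)
  replace h2 := h2.trans h
  rw [hsum] at h2
  have h3 : (MeasurableEquiv.funUnique (Fin 1) ℝ).symm ⁻¹' openSimplex 1 = Set.Ioo 0 1 := by
    ext u
    simp [openSimplex, MeasurableEquiv.funUnique]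
  rw [h3] at h2
  have h4 : ∀ u : ℝ, (dirichletKernel b ((MeasurableEquiv.funUnique (Fin 1) ℝ).symm u) : ℂ) *
      (Real.Gamma a * simplexMean ζ ((MeasurableEquiv.funUnique (Fin 1) ℝ).symm u) ^ (-(a : ℂ))) =
      Real.Gamma a * (((u ^ (c - 1) * (1 - u) ^ (a - c - 1) : ℝ) : ℂ) *
        (1 + (u : ℂ) * z) ^ (-(a : ℂ))) := by
    intro u
    have hS : simplexMean ζ ((MeasurableEquiv.funUnique (Fin 1) ℝ).symm u) = 1 + u * z := by
      simp [simplexMean, hζ_def, MeasurableEquiv.funUnique]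
      ring
    rw [hS]
    simp [dirichletKernel, hb_def, MeasurableEquiv.funUnique]
    ring
  simp only [h4] at h2
  rw [integral_const_mul] at h2
  have h5 : ∏ j, ((Real.Gamma (b j) : ℂ) * ζ j ^ (-(b j : ℂ))) =
      Real.Gamma c * (1 + z) ^ (-(c : ℂ)) * Real.Gamma (a - c) := by
    simp [hb_def, hζ_def]
  rw [h5] at h2
  have hΓa' : (Real.Gamma a : ℂ) ≠ 0 := by exact_mod_cast hΓa
  have hΓc' : (Real.Gamma c : ℂ) ≠ 0 := by exact_mod_cast hΓc
  have hΓq' : (Real.Gamma (a - c) : ℂ) ≠ 0 := by exact_mod_cast hΓq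
  rw [Complex.ofReal_div, Complex.ofReal_mul, div_mul_eq_mul_div, h2]
  field_simp

/-! ### The Markov–Krein identity for simple functions. -/

section

variable {Ω E : Type*} [MeasurableSpace Ω] [MeasurableSpace E] {α : Measure Ω} {P : Measure E}
  {m : E → ProbabilityMeasure Ω}

theorem SimpleFunc.integral_comp_eq_sum (μ : Measure Ω) [IsFiniteMeasure μ] (h : SimpleFunc Ω ℂ)
    (φ : ℂ → ℂ) : ∫ x, φ (h x) ∂μ = ∑ y ∈ h.range, (μ.real (h ⁻¹' {y}) : ℂ) * φ y := by
  classical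
  have h1 : ∀ x, φ (h x) = ∑ y ∈ h.range, (h ⁻¹' {y}).indicator (fun _ => φ y) x := by
    intro x
    rw [Finset.sum_eq_single_of_mem (h x) (SimpleFunc.mem_range_self h x)]
    · simp
    · intro y _ hy
      exact Set.indicator_of_notMem (fun hx => hy (by simpa using hx.symm)) _
  simp only [h1]
  rw [integral_finsetSum]
  · refine Finset.sum_congr rfl fun y _ => ?_
    rw [integral_indicator_const _ (h.measurableSet_fiber y), Complex.real_smul]
  · exact fun y _ => (integrable_const _).indicator (h.measurableSet_fiber y)

/-- The fibres of `h` form a partition into sets of positive mass, so `∫ h dm` is the simplex mean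
of a Dirichlet vector. -/
theorem IsDirichletProcess.integral_cpow_simpleFunc_of_pos [IsFiniteMeasure α]
    (hm : IsDirichletProcess α P m) (hα : α ≠ 0) (h : SimpleFunc Ω ℂ)
    (hre : ∀ x, 0 < (h x).re) (hpos : ∀ y ∈ h.range, 0 < α (h ⁻¹' {y})) :
    ∫ e, (∫ x, h x ∂(m e : Measure Ω)) ^ (-(α.real Set.univ : ℂ)) ∂P =
      Complex.exp (-∫ x, Complex.log (h x) ∂α) := by
  classical
  have hne : Nonempty Ω := by
    by_contra hΩ
    rw [not_nonempty_iff] at hΩ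
    exact hα (Measure.eq_zero_of_isEmpty α)
  have hcard : 0 < h.range.card := Finset.card_pos.2 ⟨h hne.some, SimpleFunc.mem_range_self h _⟩
  obtain ⟨n, hn⟩ : ∃ n, h.range.card = n + 1 := ⟨_, (Nat.succ_pred_eq_of_pos hcard).symm⟩
  let σ : Fin (n + 1) ≃ h.range := (h.range.equivFinOfCardEq hn).symm
  let C : Fin (n + 1) → Set Ω := fun i => h ⁻¹' {(σ i : ℂ)}
  let ζ : Fin (n + 1) → ℂ := fun i => σ i
  have hCm : ∀ i, MeasurableSet (C i) := fun i => h.measurableSet_fiber _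
  have hCd : Pairwise fun i j => Disjoint (C i) (C j) := fun i j hij =>
    Disjoint.preimage _ (Set.disjoint_singleton.2 fun hσ => hij (σ.injective (Subtype.ext hσ)))
  have hCu : (⋃ i, C i) = Set.univ := by
    refine Set.eq_univ_of_forall fun x => Set.mem_iUnion.2
      ⟨σ.symm ⟨h x, SimpleFunc.mem_range_self h x⟩, ?_⟩
    simp [C]
  have hCp : ∀ i, 0 < α (C i) := fun i => hpos _ (σ i).2
  have hsum : ∀ (μ : Measure Ω) [IsFiniteMeasure μ] (φ : ℂ → ℂ),
      ∫ x, φ (h x) ∂μ = ∑ i, (μ.real (C i) : ℂ) * φ (ζ i) := by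
    intro μ _ φ
    rw [SimpleFunc.integral_comp_eq_sum, ← Finset.sum_coe_sort]
    exact (Equiv.sum_comp σ fun y : h.range => (μ.real (h ⁻¹' {(y : ℂ)}) : ℂ) * φ y).symm
  have htot : ∀ (μ : Measure Ω) [IsFiniteMeasure μ], ∑ i, μ.real (C i) = μ.real Set.univ := by
    intro μ _
    rw [← hCu, measureReal_iUnion_fintype hCd hCm]
  have hζ : ∀ i, 0 < (ζ i).re := fun i => by
    obtain ⟨x, hx⟩ := SimpleFunc.mem_range.1 (σ i).2
    have := hre x
    rwa [hx] at this
  have hb : ∀ i, 0 < α.real (C i) := fun i =>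
    ENNReal.toReal_pos (hCp i).ne' (measure_ne_top _ _)
  have hmean : ∀ e, ∫ x, h x ∂(m e : Measure Ω) =
      simplexMean ζ fun i => (m e : Measure Ω).real (C i.castSucc) := by
    intro e
    have h1 := hsum (m e : Measure Ω) id
    have h2 := htot (m e : Measure Ω)
    rw [probReal_univ, Fin.sum_univ_castSucc] at h2
    simp only [id] at h1
    rw [h1, Fin.sum_univ_castSucc, simplexMean, ← h2, add_sub_cancel_left]
  have hmeas : Measurable fun e (i : Fin n) => (m e : Measure Ω).real (C i.castSucc) := by
    refine measurable_pi_iff.2 fun i => Measurable.ennreal_toReal ?_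
    exact (Measure.measurable_coe (hCm _)).comp (measurable_subtype_coe.comp hm.measurable)
  simp only [hmean]
  have h3 := integral_map (μ := P) hmeas.aemeasurable
    (f := fun u => simplexMean ζ u ^ (-((∑ j, α.real (C j) : ℝ) : ℂ)))
    ((measurable_simplexMean ζ).pow_const _).aestronglyMeasurable
  rw [hm.map_eq n C hCm hCd hCu hCp, integral_dirichletMeasure_cpow hb hζ] at h3
  rw [htot α] at h3
  rw [← h3, hsum α Complex.log, ← Finset.sum_neg_distrib, Complex.exp_sum]
  refine Finset.prod_congr rfl fun i _ => ?_
  have : ζ i ≠ 0 := fun h0 => by have := hζ i; simp [h0] at this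
  rw [Complex.cpow_def_of_ne_zero this]
  ring_nf

theorem IsDirichletProcess.integral_cpow_simpleFunc [IsFiniteMeasure α]
    (hm : IsDirichletProcess α P m) (hα : α ≠ 0) (h : SimpleFunc Ω ℂ) (hre : ∀ x, 0 < (h x).re) :
    ∫ e, (∫ x, h x ∂(m e : Measure Ω)) ^ (-(α.real Set.univ : ℂ)) ∂P =
      Complex.exp (-∫ x, Complex.log (h x) ∂α) := by
  classical
  have hU : ∀ x, x ∈ ⋃ y ∈ h.range, h ⁻¹' {y} := fun x =>
    Set.mem_biUnion (SimpleFunc.mem_range_self h x) rfl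
  obtain ⟨y₀, hy₀, hy₀p⟩ : ∃ y ∈ h.range, α (h ⁻¹' {y}) ≠ 0 := by
    by_contra hcon
    push Not at hcon
    refine hα (Measure.measure_univ_eq_zero.1 ?_)
    rw [← Set.eq_univ_of_forall hU]
    exact (measure_biUnion_null_iff h.range.countable_toSet).2 hcon
  -- Null fibres are merged into that of a charged value `y₀`. This changes `h` only on `N`, which
  -- is null for `α` and, by `ae_null`, almost surely null for `m e`; every fibre left has positive
  -- mass.
  let ψ : ℂ → ℂ := fun y => if α (h ⁻¹' {y}) = 0 then y₀ else y
  let N : Set Ω := ⋃ y ∈ h.range.filter fun y => α (h ⁻¹' {y}) = 0, h ⁻¹' {y}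
  have hNm : MeasurableSet N := Finset.measurableSet_biUnion _ fun y _ => h.measurableSet_fiber y
  have hN0 : α N = 0 := by
    refine (measure_biUnion_null_iff (Finset.countable_toSet _)).2 fun y hy => ?_
    exact (Finset.mem_filter.1 hy).2
  have hψ : ∀ x, x ∉ N → ψ (h x) = h x := by
    intro x hx
    refine if_neg fun h0 => hx ?_
    exact Set.mem_biUnion (Finset.mem_coe.2 (Finset.mem_filter.2
      ⟨SimpleFunc.mem_range_self h x, h0⟩)) rfl
  have hae : ∀ μ : Measure Ω, μ N = 0 → ∀ᵐ x ∂μ, (h.map ψ) x = h x := fun μ hμ => by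
    filter_upwards [measure_eq_zero_iff_ae_notMem.1 hμ] with x hx using hψ x hx
  obtain ⟨x₀, hx₀⟩ := SimpleFunc.mem_range.1 hy₀
  have hψα : ∀ y, α (h ⁻¹' {ψ y}) ≠ 0 := by
    intro y
    by_cases hy : α (h ⁻¹' {y}) = 0
    · simpa [ψ, hy] using hy₀p
    · simp [ψ, hy]
  have key := hm.integral_cpow_simpleFunc_of_pos hα (h.map ψ)
    (fun x => by
      rw [SimpleFunc.map_apply]
      by_cases hx : α (h ⁻¹' {h x}) = 0
      · simp only [ψ, if_pos hx, ← hx₀]; exact hre x₀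
      · simp only [ψ, if_neg hx]; exact hre x)
    (fun y hy => by
      obtain ⟨x, rfl⟩ := SimpleFunc.mem_range.1 hy
      rw [SimpleFunc.map_apply]
      refine (pos_iff_ne_zero.2 (hψα (h x))).trans_le (measure_mono fun z hz => ?_)
      have hz' : h z = ψ (h x) := hz
      have : ψ (h z) = h z := if_neg (by rw [hz']; exact hψα (h x))
      simpa [hz'] using this)
  rw [integral_congr_ae ((hae α hN0).mono fun x hx => by rw [hx])] at key
  rw [← key]
  refine integral_congr_ae ?_
  filter_upwards [hm.ae_null N hNm hN0] with e he
  rw [integral_congr_ae (hae _ he)]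

end

/-! ### General integrands and almost sure integrability. -/

section

theorem norm_cpow_neg_le {z : ℂ} {δ a : ℝ} (hδ : 0 < δ) (hz : δ ≤ ‖z‖) (ha : 0 ≤ a) :
    ‖z ^ (-(a : ℂ))‖ ≤ δ ^ (-a) := by
  rw [← Complex.ofReal_neg, Complex.norm_cpow_real]
  exact Real.rpow_le_rpow_of_nonpos hδ hz (neg_nonpos.2 ha)

theorem norm_clog_le {z : ℂ} {δ : ℝ} (hδ : 0 < δ) (hz : δ ≤ ‖z‖) :
    ‖Complex.log z‖ ≤ |Real.log δ| + Real.log (1 + ‖z‖) + Real.pi := by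
  have h1 : ‖Complex.log z‖ ≤ |(Complex.log z).re| + |(Complex.log z).im| :=
    Complex.norm_le_abs_re_add_abs_im _
  rw [Complex.log_re, Complex.log_im] at h1
  have h2 : |Complex.arg z| ≤ Real.pi := Complex.abs_arg_le_pi z
  have h3 : Real.log δ ≤ Real.log ‖z‖ := Real.log_le_log hδ hz
  have h4 : Real.log ‖z‖ ≤ Real.log (1 + ‖z‖) :=
    Real.log_le_log (hδ.trans_le hz) (by linarith)
  have h5 : 0 ≤ Real.log (1 + ‖z‖) := Real.log_nonneg (by linarith [norm_nonneg z])
  have h6 : |Real.log ‖z‖| ≤ |Real.log δ| + Real.log (1 + ‖z‖) :=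
    abs_le.2 ⟨by linarith [neg_abs_le (Real.log δ)], by linarith [abs_nonneg (Real.log δ)]⟩
  linarith

/-- Both arguments lie in `(-π/2, π/2)`, so their sum remains in the principal range. -/
theorem clog_mul_of_re_pos {x y : ℂ} (hx : 0 < x.re) (hy : 0 < y.re) :
    Complex.log (x * y) = Complex.log x + Complex.log y := by
  have h1 := abs_lt.1 (Complex.abs_arg_lt_pi_div_two_iff.2 (Or.inl hx))
  have h2 := abs_lt.1 (Complex.abs_arg_lt_pi_div_two_iff.2 (Or.inl hy))
  have hx0 : x ≠ 0 := fun h => by simp [h] at hx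
  have hy0 : y ≠ 0 := fun h => by simp [h] at hy
  exact Complex.log_mul hx0 hy0 ⟨by linarith, by linarith⟩

variable {Ω E : Type*} [MeasurableSpace Ω] [MeasurableSpace E] {α : Measure Ω} {P : Measure E}
  {m : E → ProbabilityMeasure Ω}

theorem IsDirichletProcess.measurable_coe (hm : IsDirichletProcess α P m) :
    Measurable fun e => (m e : Measure Ω) :=
  measurable_subtype_coe.comp hm.measurable

theorem IsDirichletProcess.measurable_integral (hm : IsDirichletProcess α P m) {F : Type*}
    [NormedAddCommGroup F] [NormedSpace ℝ F] [MeasurableSpace F] [BorelSpace F]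
    {h : Ω → F} (hh : StronglyMeasurable h) :
    Measurable fun e => ∫ x, h x ∂(m e : Measure Ω) := by
  let κ : Kernel E Ω := ⟨fun e => (m e : Measure Ω), hm.measurable_coe⟩
  exact (hh.integral_kernel (κ := κ)).measurable

theorem le_re_integral (μ : Measure Ω) [IsProbabilityMeasure μ] {h : Ω → ℂ} {δ : ℝ}
    (hi : Integrable h μ) (hre : ∀ x, δ ≤ (h x).re) : δ ≤ (∫ x, h x ∂μ).re := by
  have h1 : (∫ x, h x ∂μ).re = ∫ x, (h x).re ∂μ := (integral_re hi).symm
  have h2 : ∫ _, δ ∂μ ≤ ∫ x, (h x).re ∂μ := integral_mono (integrable_const _) hi.re hre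
  rw [h1]
  simpa using h2

/-- The Markov–Krein identity `E (∫ h dm)^(-a) = exp (-∫ log h dα)` for complex integrands with
real part bounded below. -/
theorem IsDirichletProcess.integral_cpow [IsFiniteMeasure α] [IsProbabilityMeasure P]
    (hm : IsDirichletProcess α P m) (hα : α ≠ 0) {h : Ω → ℂ} (hh : Measurable h) {δ : ℝ}
    (hδ : 0 < δ) (hre : ∀ x, δ ≤ (h x).re)
    (hlog : Integrable (fun x => Real.log (1 + ‖h x‖)) α)
    (hint : ∀ᵐ e ∂P, Integrable h (m e : Measure Ω)) :
    ∫ e, (∫ x, h x ∂(m e : Measure Ω)) ^ (-(α.real Set.univ : ℂ)) ∂P =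
      Complex.exp (-∫ x, Complex.log (h x) ∂α) := by
  -- Approximating inside this half-plane keeps real parts at least `δ`. This bounds the powers by a
  -- constant, controls the logarithms from below and avoids the branch cut.
  set S : Set ℂ := {z | δ ≤ z.re} with hS
  have h₀ : (δ : ℂ) ∈ S := by simp [hS]
  set f : ℕ → SimpleFunc Ω ℂ := SimpleFunc.approxOn h hh S δ h₀ with hf
  have hfS : ∀ n x, δ ≤ (f n x).re := fun n x => SimpleFunc.approxOn_mem hh h₀ n x
  have hft : ∀ x, Filter.Tendsto (fun n => f n x) Filter.atTop (nhds (h x)) := fun x =>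
    SimpleFunc.tendsto_approxOn hh h₀ (subset_closure (hre x))
  -- The approximants are within `2‖h x - δ‖` of the base point `δ`, whence `2‖h x‖ + 2δ + δ`.
  have hfb : ∀ n x, ‖f n x‖ ≤ 2 * ‖h x‖ + 3 * δ := by
    intro n x
    have h1 := SimpleFunc.norm_approxOn_y₀_le hh h₀ x n
    have h2 : ‖f n x‖ ≤ ‖f n x - δ‖ + ‖(δ : ℂ)‖ := by simpa using norm_add_le (f n x - δ) (δ : ℂ)
    have h3 : ‖h x - δ‖ ≤ ‖h x‖ + ‖(δ : ℂ)‖ := norm_sub_le _ _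
    rw [Complex.norm_real, Real.norm_of_nonneg hδ.le] at h2 h3
    linarith
  have hle : ∀ z : ℂ, δ ≤ z.re → δ ≤ ‖z‖ := fun z hz => hz.trans (Complex.re_le_norm z)
  have hslit : ∀ z : ℂ, δ ≤ z.re → z ∈ Complex.slitPlane := fun z hz => Or.inl (hδ.trans_le hz)
  have hlim1 : Filter.Tendsto (fun n => Complex.exp (-∫ x, Complex.log (f n x) ∂α)) Filter.atTop
      (nhds (Complex.exp (-∫ x, Complex.log (h x) ∂α))) := by
    refine (Complex.continuous_exp.tendsto _).comp (Filter.Tendsto.neg ?_)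
    refine tendsto_integral_of_dominated_convergence
      (fun x => |Real.log δ| + (Real.log (2 + 3 * δ) + Real.log (1 + ‖h x‖)) + Real.pi)
      (fun n => (Complex.measurable_log.comp (f n).measurable).aestronglyMeasurable)
      (((integrable_const _).add ((integrable_const _).add hlog)).add (integrable_const _))
      (fun n => Filter.Eventually.of_forall fun x => ?_)
      (Filter.Eventually.of_forall fun x => ?_)
    · refine (norm_clog_le hδ (hle _ (hfS n x))).trans ?_
      have hn := norm_nonneg (h x)
      rw [← Real.log_mul (by positivity) (by positivity)]
      have : Real.log (1 + ‖f n x‖) ≤ Real.log ((2 + 3 * δ) * (1 + ‖h x‖)) :=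
        Real.log_le_log (by positivity) (by nlinarith [hfb n x, mul_nonneg hδ.le hn])
      linarith
    · exact ((continuousAt_clog (hslit _ (hre x))).tendsto).comp (hft x)
  have hfi : ∀ n (μ : Measure Ω) [IsProbabilityMeasure μ], Integrable (f n) μ := fun n μ _ =>
    SimpleFunc.integrable_of_isFiniteMeasure _
  have hlim2 : Filter.Tendsto (fun n => ∫ e, (∫ x, f n x ∂(m e : Measure Ω)) ^
      (-(α.real Set.univ : ℂ)) ∂P) Filter.atTop
      (nhds (∫ e, (∫ x, h x ∂(m e : Measure Ω)) ^ (-(α.real Set.univ : ℂ)) ∂P)) := by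
    refine tendsto_integral_of_dominated_convergence (fun _ => δ ^ (-α.real Set.univ))
      (fun n => ((hm.measurable_integral (f n).stronglyMeasurable).pow_const
        _).aestronglyMeasurable) (integrable_const _)
      (fun n => Filter.Eventually.of_forall fun e => ?_) ?_
    · exact norm_cpow_neg_le hδ (hle _ (le_re_integral _ (hfi n _) (hfS n))) measureReal_nonneg
    · filter_upwards [hint] with e he
      have hc := hslit _ (le_re_integral (m e : Measure Ω) he hre)
      refine ((continuousAt_cpow_const hc).tendsto).comp ?_
      refine tendsto_integral_of_dominated_convergence (fun x => 2 * ‖h x‖ + 3 * δ)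
        (fun n => (f n).measurable.aestronglyMeasurable)
        ((he.norm.const_mul 2).add (integrable_const _))
        (fun n => Filter.Eventually.of_forall fun x => hfb n x)
        (Filter.Eventually.of_forall fun x => hft x)
  refine tendsto_nhds_unique hlim2 ?_
  have : ∀ n, ∫ e, (∫ x, f n x ∂(m e : Measure Ω)) ^ (-(α.real Set.univ : ℂ)) ∂P =
      Complex.exp (-∫ x, Complex.log (f n x) ∂α) := fun n =>
    hm.integral_cpow_simpleFunc hα (f n) fun x => hδ.trans_le (hfS n x)
  simpa only [this] using hlim1

theorem log_one_add_mul_le {s t : ℝ} (hs : 0 ≤ s) (ht : 0 ≤ t) :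
    Real.log (1 + s * t) ≤ Real.log (1 + s) + Real.log (1 + t) := by
  rw [← Real.log_mul (by positivity) (by positivity)]
  exact Real.log_le_log (by positivity) (by nlinarith)

/-- A log-integrable function is almost surely integrable with respect to a Dirichlet process. -/
theorem IsDirichletProcess.ae_integrable [IsFiniteMeasure α] [IsProbabilityMeasure P]
    (hm : IsDirichletProcess α P m) (hα : α ≠ 0) {g : Ω → ℝ} (hg : Measurable g)
    (hlog : Integrable (fun x => Real.log (1 + |g x|)) α) :
    ∀ᵐ e ∂P, Integrable g (m e : Measure Ω) := by
  set a : ℝ := α.real Set.univ with ha_def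
  have ha : 0 < a := ENNReal.toReal_pos (by simpa using hα) (measure_ne_top _ _)
  set A : Set E := {e | Integrable g (m e : Measure Ω)} with hA
  have hAm : MeasurableSet A := by
    have : A = {e | ∫⁻ x, ENNReal.ofReal |g x| ∂(m e : Measure Ω) < ⊤} := by
      ext e
      simp only [hA, Set.mem_ofPred_eq]
      rw [Integrable, and_iff_right hg.aestronglyMeasurable, hasFiniteIntegral_iff_norm]
      rfl
    rw [this]
    refine measurableSet_lt ?_ measurable_const
    exact (Measure.measurable_lintegral (by fun_prop)).comp hm.measurable_coe
  -- The truncations `k n` of `1 + s|g|` are bounded, so the identity applies to them. The variable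
  -- `(∫ k n dm)^(-a)` is at most `1`, and tends to `0` wherever `g` is not integrable; its
  -- expectation is therefore at most `P(A)` in the limit.
  have hbound : ∀ s : ℝ, 0 < s → Real.exp (-∫ x, Real.log (1 + s * |g x|) ∂α) ≤ P.real A := by
    intro s hs
    set k : ℕ → Ω → ℝ := fun n x => 1 + s * min |g x| n with hk
    have hkm : ∀ n, Measurable (k n) := fun n => by simp only [hk]; fun_prop
    have hk1 : ∀ n x, 1 ≤ k n x := fun n x => by
      have : 0 ≤ s * min |g x| n := mul_nonneg hs.le (le_min (abs_nonneg _) (Nat.cast_nonneg _))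
      simp only [hk]; linarith
    have hkb : ∀ n x, k n x ≤ 1 + s * n := fun n x => by
      have := mul_le_mul_of_nonneg_left (min_le_right |g x| (n : ℝ)) hs.le
      simp only [hk]; linarith
    have hkg : ∀ n x, k n x ≤ 1 + s * |g x| := fun n x => by
      have := mul_le_mul_of_nonneg_left (min_le_left |g x| (n : ℝ)) hs.le
      simp only [hk]; linarith
    have hki : ∀ n (μ : Measure Ω) [IsFiniteMeasure μ], Integrable (k n) μ := fun n μ _ =>
      Integrable.of_bound (hkm n).aestronglyMeasurable (1 + s * n)
        (Filter.Eventually.of_forall fun x => by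
          rw [Real.norm_of_nonneg (zero_le_one.trans (hk1 n x))]; exact hkb n x)
    have hlogs : Integrable (fun x => Real.log (1 + s * |g x|)) α := by
      refine Integrable.mono' ((integrable_const (Real.log (1 + s))).add hlog)
        (Measurable.aestronglyMeasurable (by fun_prop)) (Filter.Eventually.of_forall fun x => ?_)
      have : 0 ≤ s * |g x| := by positivity
      rw [Real.norm_of_nonneg (Real.log_nonneg (by linarith))]
      exact log_one_add_mul_le hs.le (abs_nonneg _)
    have hMK : ∀ n, ∫ e, (∫ x, k n x ∂(m e : Measure Ω)) ^ (-a) ∂P =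
        Real.exp (-∫ x, Real.log (k n x) ∂α) := by
      intro n
      have h := hm.integral_cpow hα (h := fun x => (k n x : ℂ)) (by fun_prop) one_pos
        (fun x => by simpa using hk1 n x)
        (Integrable.of_bound (Measurable.aestronglyMeasurable (by fun_prop))
          (Real.log (1 + (1 + s * n))) (Filter.Eventually.of_forall fun x => by
            rw [Complex.norm_real, Real.norm_of_nonneg (zero_le_one.trans (hk1 n x)),
              Real.norm_of_nonneg (Real.log_nonneg (by linarith [hk1 n x]))]
            exact Real.log_le_log (by linarith [hk1 n x]) (by linarith [hkb n x])))
        (Filter.Eventually.of_forall fun e => (hki n _).ofReal)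
      have h1 : ∀ e, (∫ x, (k n x : ℂ) ∂(m e : Measure Ω)) ^ (-(a : ℂ)) =
          (((∫ x, k n x ∂(m e : Measure Ω)) ^ (-a) : ℝ) : ℂ) := by
        intro e
        rw [integral_complex_ofReal, Complex.ofReal_cpow, Complex.ofReal_neg]
        exact integral_nonneg fun x => zero_le_one.trans (hk1 n x)
      have h2 : ∫ x, Complex.log (k n x) ∂α = ((∫ x, Real.log (k n x) ∂α : ℝ) : ℂ) := by
        rw [← integral_complex_ofReal]
        refine integral_congr_ae (Filter.Eventually.of_forall fun x => ?_)
        exact (Complex.ofReal_log (zero_le_one.trans (hk1 n x))).symm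
      rw [← ha_def] at h
      simp only [h1] at h
      rw [integral_complex_ofReal, h2, ← Complex.ofReal_neg, ← Complex.ofReal_exp] at h
      exact_mod_cast h
    have hge : ∀ n, Real.exp (-∫ x, Real.log (1 + s * |g x|) ∂α) ≤
        ∫ e, (∫ x, k n x ∂(m e : Measure Ω)) ^ (-a) ∂P := by
      intro n
      rw [hMK]
      refine Real.exp_le_exp.2 (neg_le_neg (integral_mono_of_nonneg
        (Filter.Eventually.of_forall fun x => Real.log_nonneg (hk1 n x)) hlogs
        (Filter.Eventually.of_forall fun x => ?_)))
      exact Real.log_le_log (zero_lt_one.trans_le (hk1 n x)) (hkg n x)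
    have hint1 : ∀ n e, 1 ≤ ∫ x, k n x ∂(m e : Measure Ω) := fun n e => by
      have := integral_mono (integrable_const 1) (hki n (m e : Measure Ω)) (hk1 n)
      simpa using this
    -- The means increase with `n`; were they bounded, Fatou's lemma would make `1 + s|g|`
    -- integrable.
    have hlim : ∀ e, e ∉ A → Filter.Tendsto
        (fun n => (∫ x, k n x ∂(m e : Measure Ω)) ^ (-a)) Filter.atTop (nhds 0) := by
      intro e he
      refine (tendsto_rpow_neg_atTop ha).comp ?_
      have hmono : Monotone fun n => ∫ x, k n x ∂(m e : Measure Ω) := by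
        intro n n' hn
        refine integral_mono (hki n _) (hki n' _) fun x => ?_
        have : (n : ℝ) ≤ n' := by exact_mod_cast hn
        simp only [hk]
        gcongr
      refine (tendsto_atTop_of_monotone hmono).resolve_right ?_
      rintro ⟨l, hl⟩
      refine he ?_
      have hI : Integrable (fun x => 1 + s * |g x|) (m e : Measure Ω) := by
        refine ⟨Measurable.aestronglyMeasurable (by fun_prop), ?_⟩
        have hkt : ∀ x, Filter.Tendsto (fun n => k n x) Filter.atTop (nhds (1 + s * |g x|)) := by
          intro x
          refine tendsto_const_nhds.congr' ?_
          filter_upwards [Filter.eventually_ge_atTop ⌈|g x|⌉₊] with n hn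
          simp only [hk]
          rw [min_eq_left ((Nat.le_ceil _).trans (by exact_mod_cast hn))]
        have hFatou := lintegral_liminf_le (μ := (m e : Measure Ω))
          (u := Filter.atTop) fun n => (hkm n).enorm
        simp only [fun x => ((hkt x).enorm).liminf_eq] at hFatou
        refine (hFatou.trans (Filter.liminf_le_of_frequently_le'
          (Filter.Frequently.of_forall fun n => ?_))).trans_lt (ENNReal.ofReal_lt_top (r := l))
        rw [← ofReal_integral_norm_eq_lintegral_enorm (hki n _)]
        refine ENNReal.ofReal_le_ofReal ?_
        simp only [Real.norm_of_nonneg (zero_le_one.trans (hk1 n _))]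
        exact hmono.ge_of_tendsto hl n
      have h3 : Integrable (fun x => |g x|) (m e : Measure Ω) := by
        refine ((hI.sub (integrable_const 1)).const_mul s⁻¹).congr
          (Filter.Eventually.of_forall fun x => ?_)
        simp only [Pi.sub_apply]
        field_simp
        ring
      exact (integrable_norm_iff hg.aestronglyMeasurable).1 h3
    have hlim2 : Filter.Tendsto (fun n => ∫ e in Aᶜ, (∫ x, k n x ∂(m e : Measure Ω)) ^ (-a) ∂P)
        Filter.atTop (nhds (∫ e in Aᶜ, (0 : ℝ) ∂P)) := by
      refine tendsto_integral_of_dominated_convergence (fun _ => 1)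
        (fun n => ((hm.measurable_integral (hkm n).stronglyMeasurable).pow_const
          _).aestronglyMeasurable) (integrable_const _)
        (fun n => Filter.Eventually.of_forall fun e => ?_)
        (ae_restrict_of_forall_mem hAm.compl hlim)
      rw [Real.norm_of_nonneg (Real.rpow_nonneg (zero_le_one.trans (hint1 n e)) _)]
      exact Real.rpow_le_one_of_one_le_of_nonpos (hint1 n e) (by linarith)
    rw [integral_zero] at hlim2
    have hle : ∀ n, Real.exp (-∫ x, Real.log (1 + s * |g x|) ∂α) ≤
        P.real A + ∫ e in Aᶜ, (∫ x, k n x ∂(m e : Measure Ω)) ^ (-a) ∂P := by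
      intro n
      have hI : Integrable (fun e => (∫ x, k n x ∂(m e : Measure Ω)) ^ (-a)) P :=
        Integrable.of_bound ((hm.measurable_integral (hkm n).stronglyMeasurable).pow_const
          _).aestronglyMeasurable 1 (Filter.Eventually.of_forall fun e => by
            rw [Real.norm_of_nonneg (Real.rpow_nonneg (zero_le_one.trans (hint1 n e)) _)]
            exact Real.rpow_le_one_of_one_le_of_nonpos (hint1 n e) (by linarith))
      refine (hge n).trans ?_
      rw [← integral_add_compl hAm hI]
      refine add_le_add_left ?_ _
      have h4 : ∫ e in A, (∫ x, k n x ∂(m e : Measure Ω)) ^ (-a) ∂P ≤ ∫ e in A, (1 : ℝ) ∂P :=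
        integral_mono hI.integrableOn (integrable_const _) fun e =>
          Real.rpow_le_one_of_one_le_of_nonpos (hint1 n e) (by linarith)
      simpa using h4
    have := ge_of_tendsto' (hlim2.const_add (P.real A)) hle
    simpa using this
  -- Along `s = 1/(n + 1)` the lower bound for `P(A)` tends to `1`, dominated by the
  -- log-integrability of `g`.
  have hlim : Filter.Tendsto (fun n : ℕ => Real.exp (-∫ x, Real.log (1 + (1 / ((n : ℝ) + 1)) *
      |g x|) ∂α)) Filter.atTop (nhds (Real.exp (-∫ _, (0 : ℝ) ∂α))) := by
    refine (Real.continuous_exp.tendsto _).comp (Filter.Tendsto.neg ?_)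
    refine tendsto_integral_of_dominated_convergence (fun x => Real.log (1 + |g x|))
      (fun n => Measurable.aestronglyMeasurable (by fun_prop)) hlog
      (fun n => Filter.Eventually.of_forall fun x => ?_)
      (Filter.Eventually.of_forall fun x => ?_)
    · have h1 : 1 / ((n : ℝ) + 1) ≤ 1 := by
        rw [div_le_one (by positivity)]
        linarith [(Nat.cast_nonneg n : (0 : ℝ) ≤ n)]
      have h2 : 0 ≤ 1 / ((n : ℝ) + 1) * |g x| := by positivity
      rw [Real.norm_of_nonneg (Real.log_nonneg (by linarith))]
      exact Real.log_le_log (by linarith) (by nlinarith [abs_nonneg (g x)])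
    · have h1 := (tendsto_one_div_add_atTop_nhds_zero_nat (𝕜 := ℝ)).mul_const |g x|
      have h2 := (h1.const_add 1).log (by simp)
      simpa using h2
  have h1 : 1 ≤ P.real A := by
    have := le_of_tendsto' hlim fun n => hbound _ (by positivity)
    simpa using this
  have h2 : P A = 1 := by
    refine le_antisymm prob_le_one ?_
    rw [← ENNReal.ofReal_one]
    exact (ENNReal.ofReal_le_iff_le_toReal (measure_ne_top _ _)).2 h1
  exact (mem_ae_iff_prob_eq_one hAm).2 h2

end

/-! ### The identity for `1 + iwg` in the half-plane `Re w > 0`. -/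

section

variable {Ω E : Type*} [MeasurableSpace Ω] [MeasurableSpace E] {α : Measure Ω} {P : Measure E}
  {m : E → ProbabilityMeasure Ω}

/-- `E (1 + i w ∫ g dm)^(-a) = exp (-∫ log (1 + i w g) dα)` for `Re w > 0`. -/
theorem IsDirichletProcess.integral_cpow_one_add_I_mul [IsFiniteMeasure α] [IsProbabilityMeasure P]
    (hm : IsDirichletProcess α P m) (hα : α ≠ 0) {g : Ω → ℝ} (hg : Measurable g)
    (hlog : Integrable (fun x => Real.log (1 + |g x|)) α) {w : ℂ} (hw : 0 < w.re) :
    ∫ e, (1 + Complex.I * w * ((∫ x, g x ∂(m e : Measure Ω) : ℝ) : ℂ)) ^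
        (-(α.real Set.univ : ℂ)) ∂P = expNegLogIntegral α g w := by
  have hw0 : w ≠ 0 := fun h => by simp [h] at hw
  have hn : 0 < ‖w‖ := norm_pos_iff.2 hw0
  -- The real part of `1 + iwy` need not be positive, but multiplication by this unit turns it into
  -- `κ + i‖w‖y`, whose real part is `Re κ > 0` whatever `y` is.
  set κ : ℂ := ‖w‖ / w with hκ
  have hκinv : κ⁻¹ = w / ‖w‖ := by rw [hκ, inv_div]
  have hκ0 : κ ≠ 0 := div_ne_zero (by exact_mod_cast hn.ne') hw0
  have hκinv_re : 0 < (κ⁻¹).re := by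
    rw [hκinv, Complex.div_ofReal_re]
    exact div_pos hw hn
  have hκw : κ * w = ‖w‖ := div_mul_cancel₀ _ hw0
  have hκ_norm : ‖κ‖ = 1 := by
    rw [hκ, norm_div, Complex.norm_real, norm_norm, div_self hn.ne']
  have hκ_re : 0 < κ.re := by
    rw [Complex.inv_re] at hκinv_re
    exact (div_pos_iff_of_pos_right (Complex.normSq_pos.2 hκ0)).1 hκinv_re
  have hmul : ∀ y : ℝ, κ * (1 + Complex.I * w * y) = κ + Complex.I * (‖w‖ * y : ℝ) := by
    intro y
    push_cast
    linear_combination (Complex.I * y) * hκw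
  have hre : ∀ y : ℝ, (κ * (1 + Complex.I * w * y)).re = κ.re := by
    intro y
    rw [hmul, Complex.add_re, Complex.I_mul_re, Complex.ofReal_im, neg_zero, add_zero]
  have hlogmul : ∀ y : ℝ, Complex.log (1 + Complex.I * w * y) =
      Complex.log κ⁻¹ + Complex.log (κ * (1 + Complex.I * w * y)) := by
    intro y
    rw [← clog_mul_of_re_pos hκinv_re (by rw [hre]; exact hκ_re), inv_mul_cancel_left₀ hκ0]
  have hne : ∀ y : ℝ, 1 + Complex.I * w * y ≠ 0 := fun y h0 => by
    have := hre y
    rw [h0, mul_zero, Complex.zero_re] at this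
    exact hκ_re.ne this
  have hnorm : ∀ y : ℝ, ‖κ * (1 + Complex.I * w * y)‖ ≤ 1 + ‖w‖ * |y| := by
    intro y
    rw [norm_mul, hκ_norm, one_mul]
    refine (norm_add_le _ _).trans ?_
    simp
  have hmeas : Measurable fun x => κ * (1 + Complex.I * w * (g x : ℂ)) := by fun_prop
  have hlog' : Integrable (fun x => Real.log (1 + ‖κ * (1 + Complex.I * w * (g x : ℂ))‖)) α := by
    refine Integrable.mono' ((integrable_const (Real.log (1 + (1 + ‖w‖)))).add hlog)
      (Real.measurable_log.comp (hmeas.norm.const_add 1)).aestronglyMeasurable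
      (Filter.Eventually.of_forall fun x => ?_)
    have h0 := norm_nonneg (κ * (1 + Complex.I * w * (g x : ℂ)))
    rw [Real.norm_of_nonneg (Real.log_nonneg (by linarith))]
    simp only [Pi.add_apply]
    rw [← Real.log_mul (by positivity) (by positivity)]
    exact Real.log_le_log (by linarith) (by nlinarith [hnorm (g x), abs_nonneg (g x)])
  have hae := hm.ae_integrable hα hg hlog
  have key := hm.integral_cpow hα hmeas hκ_re (fun x => (hre (g x)).ge) hlog' (by
    filter_upwards [hae] with e he
    exact ((integrable_const _).add (he.ofReal.const_mul _)).const_mul _)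
  have hlogi : Integrable (fun x => Complex.log (κ * (1 + Complex.I * w * (g x : ℂ)))) α := by
    refine Integrable.mono' (((integrable_const |Real.log κ.re|).add hlog').add
      (integrable_const Real.pi)) (Complex.measurable_log.comp hmeas).aestronglyMeasurable
      (Filter.Eventually.of_forall fun x => ?_)
    exact norm_clog_le hκ_re ((hre (g x)).ge.trans (Complex.re_le_norm _))
  -- Undoing the rotation adds the constant `log κ⁻¹` to the logarithm, which integrates to `a log
  -- κ⁻¹`; the same factor comes out of the power on the other side.
  have hR : expNegLogIntegral α g w = κ⁻¹ ^ (-(α.real Set.univ : ℂ)) *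
      Complex.exp (-∫ x, Complex.log (κ * (1 + Complex.I * w * (g x : ℂ))) ∂α) := by
    rw [expNegLogIntegral, Complex.cpow_def_of_ne_zero (inv_ne_zero hκ0), ← Complex.exp_add]
    simp only [hlogmul]
    rw [integral_add (integrable_const _) hlogi, integral_const, Complex.real_smul]
    congr 1
    ring
  rw [hR, ← key, ← integral_const_mul]
  refine integral_congr_ae ?_
  filter_upwards [hae] with e he
  have h1 : ∫ x, κ * (1 + Complex.I * w * (g x : ℂ)) ∂(m e : Measure Ω) =
      κ * (1 + Complex.I * w * ((∫ x, g x ∂(m e : Measure Ω) : ℝ) : ℂ)) := by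
    rw [integral_const_mul, integral_add (integrable_const _) (he.ofReal.const_mul _),
      integral_const_mul, integral_complex_ofReal]
    simp
  rw [h1]
  set y : ℝ := ∫ x, g x ∂(m e : Measure Ω)
  rw [Complex.cpow_def_of_ne_zero (hne y), Complex.cpow_def_of_ne_zero (inv_ne_zero hκ0),
    Complex.cpow_def_of_ne_zero (mul_ne_zero hκ0 (hne y)), ← Complex.exp_add, hlogmul]
  congr 1
  ring

end

/-! ### The loop: estimates and calculus along its pieces. -/

section

/-- A region containing the loop (apart from the origin) on which all integrands are controlled. -/
def loopRegion (δ ρ : ℝ) : Set ℂ :=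
  {w | w ≠ 0 ∧ ‖w‖ ≤ 2 ∧ δ * ‖w‖ ≤ w.re ∧ ρ ≤ ‖w - 1‖ ∧ w - 1 ∈ Complex.slitPlane}

/-- A piece `γ : (a, b] → loopRegion δ ρ` of the loop, with derivative `γ'`. -/
structure IsLoopPiece (δ ρ : ℝ) (γ γ' : ℝ → ℂ) (a b : ℝ) : Prop where
  lt : a < b
  mem : ∀ s ∈ Set.Ioc a b, γ s ∈ loopRegion δ ρ
  hasDerivAt : ∀ s, HasDerivAt γ (γ' s) s
  continuous_deriv : Continuous γ'
  integrable : ∀ c : ℝ, 0 < c →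
    IntervalIntegrable (fun s => ‖γ s‖ ^ (c - 1) * ‖γ' s‖) volume a b

theorem IsLoopPiece.continuous {δ ρ : ℝ} {γ γ' : ℝ → ℂ} {a b : ℝ} (h : IsLoopPiece δ ρ γ γ' a b) :
    Continuous γ :=
  continuous_iff_continuousAt.2 fun s => (h.hasDerivAt s).continuousAt

/-- A measurable function that is `O(|w|^(c-1))` on the loop region, with `c > 0`. -/
structure IsLoopBounded (δ ρ c : ℝ) (F : ℂ → ℂ) : Prop where
  pos : 0 < c
  measurable : Measurable F
  exists_bound : ∃ C : ℝ, ∀ w ∈ loopRegion δ ρ, ‖F w‖ ≤ C * ‖w‖ ^ (c - 1)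

theorem IsLoopPiece.intervalIntegrable_of_bound {δ ρ : ℝ} {γ γ' : ℝ → ℂ} {a b c : ℝ}
    (h : IsLoopPiece δ ρ γ γ' a b) {F : ℂ → ℂ} (hF : IsLoopBounded δ ρ c F) :
    IntervalIntegrable (fun s => F (γ s) * γ' s) volume a b := by
  obtain ⟨C, hC⟩ := hF.exists_bound
  refine ((h.integrable c hF.pos).const_mul C).mono_fun
    ((hF.measurable.comp h.continuous.measurable).mul
      h.continuous_deriv.measurable).aestronglyMeasurable ?_
  rw [Set.uIoc_of_le h.lt.le]
  refine ae_restrict_of_forall_mem measurableSet_Ioc fun s hs => ?_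
  simp only [norm_mul (F (γ s))]
  refine le_trans ?_ (le_abs_self _)
  rw [← mul_assoc]
  exact mul_le_mul_of_nonneg_right (hC _ (h.mem s hs)) (norm_nonneg _)

/-- At the left end only a limit of the primitive is asked for: the segments start at `0`, outside
the region, where `F` may blow up if `c < 1`. -/
theorem IsLoopPiece.integral_eq_sub {δ ρ : ℝ} {γ γ' : ℝ → ℂ} {a b c : ℝ}
    (h : IsLoopPiece δ ρ γ γ' a b) {F G : ℂ → ℂ} (hF : IsLoopBounded δ ρ c F)
    (hG : ∀ w ∈ loopRegion δ ρ, HasDerivAt G (F w) w) {l : ℂ}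
    (hl : Filter.Tendsto (fun s => G (γ s)) (nhdsWithin a (Set.Ioi a)) (nhds l)) :
    ∫ s in a..b, F (γ s) * γ' s = G (γ b) - l := by
  have hd : ∀ s ∈ Set.Ioc a b, HasDerivAt (fun s => G (γ s)) (F (γ s) * γ' s) s := fun s hs =>
    (hG _ (h.mem s hs)).comp s (h.hasDerivAt s)
  refine intervalIntegral.integral_eq_sub_of_hasDerivAt_of_tendsto h.lt
    (fun s hs => hd s ⟨hs.1, hs.2.le⟩) (h.intervalIntegrable_of_bound hF) hl ?_
  exact (hd b ⟨h.lt, le_rfl⟩).continuousAt.tendsto.mono_left nhdsWithin_le_nhds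

/-- The three pieces of the loop lie in a common region. -/
structure IsLoop (δ ρ ε η : ℝ) : Prop where
  δ_pos : 0 < δ
  ρ_pos : 0 < ρ
  lower_im : (circleMap 1 ε (-(Real.pi - η))).im < 0
  upper_im : 0 < (circleMap 1 ε (Real.pi - η)).im
  lower_mem : circleMap 1 ε (-(Real.pi - η)) ∈ loopRegion δ ρ
  upper_mem : circleMap 1 ε (Real.pi - η) ∈ loopRegion δ ρ
  lower : IsLoopPiece δ ρ (fun s => (s : ℂ) * circleMap 1 ε (-(Real.pi - η)))
    (fun _ => circleMap 1 ε (-(Real.pi - η))) 0 1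
  arc : IsLoopPiece δ ρ (circleMap 1 ε) (deriv (circleMap 1 ε)) (-(Real.pi - η)) (Real.pi - η)
  upper : IsLoopPiece δ ρ (fun s => (s : ℂ) * circleMap 1 ε (Real.pi - η))
    (fun _ => circleMap 1 ε (Real.pi - η)) 0 1

theorem isLoopPiece_segment {δ ρ : ℝ} {z : ℂ} (hz2 : ‖z‖ ≤ 2) (hzre : δ * ‖z‖ ≤ z.re)
    (him : z.im ≠ 0) (hρ : ρ ≤ |z.im| / 2) :
    IsLoopPiece δ ρ (fun s => (s : ℂ) * z) (fun _ => z) 0 1 := by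
  have hz0 : z ≠ 0 := fun h => him (by simp [h])
  refine ⟨one_pos, fun s hs => ⟨?_, ?_, ?_, ?_, ?_⟩, fun s => ?_, continuous_const, fun c hc => ?_⟩
  · exact mul_ne_zero (by exact_mod_cast hs.1.ne') hz0
  · rw [norm_mul, Complex.norm_real, Real.norm_of_nonneg hs.1.le]
    nlinarith [hs.2, norm_nonneg z, hs.1]
  · rw [norm_mul, Complex.norm_real, Real.norm_of_nonneg hs.1.le, Complex.re_ofReal_mul]
    nlinarith [hs.1]
  -- Distance from `1` to the line through `0` and `z`: since `conj z * (s z)` is real, `conj z * (s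
  -- z - 1)` has imaginary part `z.im`. With `‖z‖ ≤ 2` this explains the bound `|z.im| / 2`.
  · have h1 : |z.im| ≤ ‖z‖ * ‖(s : ℂ) * z - 1‖ := by
      have h2 := Complex.abs_im_le_norm (starRingEnd ℂ z * ((s : ℂ) * z - 1))
      have h3 : (starRingEnd ℂ z * ((s : ℂ) * z - 1)).im = z.im := by
        simp
        ring
      rwa [h3, norm_mul, Complex.norm_conj] at h2
    nlinarith [norm_nonneg ((s : ℂ) * z - 1)]
  · refine Or.inr ?_
    simpa using ⟨hs.1.ne', him⟩
  · simpa using (Complex.ofRealCLM.hasDerivAt (x := s)).mul_const z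
  · have h1 : IntervalIntegrable (fun s : ℝ => ‖z‖ ^ (c - 1) * ‖z‖ * s ^ (c - 1)) volume 0 1 :=
      (intervalIntegral.intervalIntegrable_rpow' (by linarith)).const_mul _
    refine h1.congr ?_
    intro s hs
    rw [Set.uIoc_of_le zero_le_one] at hs
    simp only [norm_mul, Complex.norm_real, Real.norm_of_nonneg hs.1.le]
    rw [Real.mul_rpow hs.1.le (norm_nonneg _)]
    ring

/-- On the circle `Re w ≥ 1 - ε` and `‖w‖ ≤ 2`, hence `δ = (1 - ε)/2`, a cone condition inherited by
the segments. The end points of the arc have imaginary part `±ε sin η`, hence `ρ = ε sin η / 2`,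
which is below the radius `ε`. -/
theorem exists_isLoop {ε η : ℝ} (hε : 0 < ε) (hε1 : ε < 1) (hη : 0 < η) (hηπ : η < Real.pi) :
    ∃ δ ρ, IsLoop δ ρ ε η := by
  have hsin : 0 < Real.sin η := Real.sin_pos_of_pos_of_lt_pi hη hηπ
  have hre : ∀ θ, 1 - ε ≤ (circleMap 1 ε θ).re := fun θ => by
    simp only [circleMap, Complex.add_re, Complex.one_re, Complex.re_ofReal_mul,
      Complex.exp_ofReal_mul_I_re]
    nlinarith [Real.neg_one_le_cos θ]
  have him : ∀ θ, (circleMap 1 ε θ).im = ε * Real.sin θ := fun θ => by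
    simp [circleMap, Complex.exp_ofReal_mul_I_im]
  have hnorm : ∀ θ, ‖circleMap 1 ε θ‖ ≤ 2 := fun θ => by
    have h1 : circleMap 1 ε θ = 1 + circleMap 0 ε θ := by simp [circleMap]
    rw [h1]
    refine (norm_add_le _ _).trans ?_
    rw [norm_circleMap_zero, abs_of_pos hε, norm_one]
    linarith
  have hnorm1 : ∀ θ, ‖circleMap 1 ε θ - 1‖ = ε := fun θ => by
    rw [circleMap_sub_center, norm_circleMap_zero, abs_of_pos hε]
  have hδ : 0 < (1 - ε) / 2 := by linarith
  have hδre : ∀ θ, (1 - ε) / 2 * ‖circleMap 1 ε θ‖ ≤ (circleMap 1 ε θ).re := fun θ => by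
    nlinarith [hre θ, hnorm θ]
  have hs1 : (circleMap 1 ε (-(Real.pi - η))).im = -(ε * Real.sin η) := by
    rw [him, Real.sin_neg, Real.sin_pi_sub]
    ring
  have hs2 : (circleMap 1 ε (Real.pi - η)).im = ε * Real.sin η := by
    rw [him, Real.sin_pi_sub]
  have hpos : 0 < ε * Real.sin η := mul_pos hε hsin
  have hρε : ε * Real.sin η / 2 ≤ ε := by nlinarith [Real.sin_le_one η]
  have hmem : ∀ θ, -Real.pi < θ → θ < Real.pi →
      circleMap 1 ε θ ∈ loopRegion ((1 - ε) / 2) (ε * Real.sin η / 2) := fun θ h1 h2 => by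
    refine ⟨fun h => ?_, hnorm θ, hδre θ, by rw [hnorm1]; exact hρε, ?_⟩
    · have := hre θ
      rw [h, Complex.zero_re] at this
      linarith
    · rw [Complex.mem_slitPlane_iff_arg]
      have h3 : circleMap 1 ε θ - 1 = ε * Complex.exp (θ * Complex.I) := by simp [circleMap]
      refine ⟨?_, ?_⟩
      · rw [h3, Complex.exp_mul_I, Complex.arg_mul_cos_add_sin_mul_I hε ⟨h1, h2.le⟩]
        exact h2.ne
      · intro h0
        have := hnorm1 θ
        rw [h0, norm_zero] at this
        exact hε.ne this
  refine ⟨(1 - ε) / 2, ε * Real.sin η / 2, hδ, by linarith, by rw [hs1]; linarith,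
    by rw [hs2]; exact hpos, hmem _ (by linarith) (by linarith), hmem _ (by linarith) (by linarith),
    ?_, ?_, ?_⟩
  · refine isLoopPiece_segment (hnorm _) (hδre _) (by rw [hs1]; linarith) ?_
    rw [hs1, abs_neg, abs_of_pos hpos]
  · have hcd : Continuous (deriv (circleMap 1 ε)) := by
      have : deriv (circleMap 1 ε) = fun θ => circleMap 0 ε θ * Complex.I :=
        funext fun θ => deriv_circleMap 1 ε θ
      rw [this]
      exact (continuous_circleMap 0 ε).mul continuous_const
    refine ⟨by linarith, fun s hs => hmem s (by linarith [hs.1]) (by linarith [hs.2]),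
      fun s => (differentiable_circleMap 1 ε s).hasDerivAt, hcd, fun c _ => ?_⟩
    refine Continuous.intervalIntegrable ?_ _ _
    refine Continuous.mul (Continuous.rpow_const (continuous_circleMap 1 ε).norm fun s => Or.inl ?_)
      hcd.norm
    intro h
    have := hre s
    rw [norm_eq_zero.1 h, Complex.zero_re] at this
    linarith
  · refine isLoopPiece_segment (hnorm _) (hδre _) (by rw [hs2]; exact hpos.ne') ?_
    rw [hs2, abs_of_pos hpos]

variable {δ ρ c ε η : ℝ}

/-- The fundamental theorem of calculus along the loop. -/
theorem IsLoop.loopIntegral_eq_sub (h : IsLoop δ ρ ε η) {F G : ℂ → ℂ} (hF : IsLoopBounded δ ρ c F)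
    (hG : ∀ w ∈ loopRegion δ ρ, HasDerivAt G (F w) w) {l₁ l₂ : ℂ}
    (hl₁ : Filter.Tendsto (fun s : ℝ => G (s * circleMap 1 ε (-(Real.pi - η))))
      (nhdsWithin 0 (Set.Ioi 0)) (nhds l₁))
    (hl₂ : Filter.Tendsto (fun s : ℝ => G (s * circleMap 1 ε (Real.pi - η)))
      (nhdsWithin 0 (Set.Ioi 0)) (nhds l₂)) :
    loopIntegral ε η F = l₂ - l₁ := by
  have h1 := h.lower.integral_eq_sub hF hG hl₁
  have h2 := h.upper.integral_eq_sub hF hG hl₂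
  have h3 := h.arc.integral_eq_sub hF hG (l := G (circleMap 1 ε (-(Real.pi - η))))
    (((hG _ h.lower_mem).continuousAt.comp
      (continuous_circleMap 1 ε).continuousAt).tendsto.mono_left nhdsWithin_le_nhds)
  rw [loopIntegral, segmentIntegral, segmentIntegral, h1, h2, h3]
  simp

theorem IsLoop.loopIntegral_add (h : IsLoop δ ρ ε η) {F G : ℂ → ℂ} (hF : IsLoopBounded δ ρ c F)
    (hG : IsLoopBounded δ ρ c G) :
    loopIntegral ε η (fun w => F w + G w) = loopIntegral ε η F + loopIntegral ε η G := by
  simp only [loopIntegral, segmentIntegral, add_mul]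
  rw [intervalIntegral.integral_add (h.lower.intervalIntegrable_of_bound hF)
      (h.lower.intervalIntegrable_of_bound hG),
    intervalIntegral.integral_add (h.arc.intervalIntegrable_of_bound hF)
      (h.arc.intervalIntegrable_of_bound hG),
    intervalIntegral.integral_add (h.upper.intervalIntegrable_of_bound hF)
      (h.upper.intervalIntegrable_of_bound hG)]
  ring

theorem loopIntegral_const_mul (k : ℂ) (F : ℂ → ℂ) :
    loopIntegral ε η (fun w => k * F w) = k * loopIntegral ε η F := by
  simp only [loopIntegral, segmentIntegral, mul_assoc, intervalIntegral.integral_const_mul]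
  ring

theorem IsLoop.loopIntegral_congr (h : IsLoop δ ρ ε η) {F G : ℂ → ℂ}
    (hFG : ∀ w ∈ loopRegion δ ρ, F w = G w) : loopIntegral ε η F = loopIntegral ε η G := by
  have key : ∀ {γ γ' : ℝ → ℂ} {a b : ℝ}, IsLoopPiece δ ρ γ γ' a b →
      ∫ s in a..b, F (γ s) * γ' s = ∫ s in a..b, G (γ s) * γ' s := fun hp => by
    refine intervalIntegral.integral_congr_ae (Filter.Eventually.of_forall fun s hs => ?_)
    rw [Set.uIoc_of_le hp.lt.le] at hs
    rw [hFG _ (hp.mem s hs)]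
  rw [loopIntegral, loopIntegral, segmentIntegral, segmentIntegral, segmentIntegral,
    segmentIntegral, key h.lower, key h.arc, key h.upper]

end

/-! ### The loop integral as a function of `X`: a differential equation. -/

section

variable {δ ρ c ε η : ℝ}

theorem IsLoopBounded.bounded_mul {F A : ℂ → ℂ} (hF : IsLoopBounded δ ρ c F) (hA : Measurable A)
    {M : ℝ} (hM : ∀ w ∈ loopRegion δ ρ, ‖A w‖ ≤ M) : IsLoopBounded δ ρ c fun w => A w * F w := by
  obtain ⟨C, hC⟩ := hF.exists_bound
  refine ⟨hF.pos, hA.mul hF.measurable, M * C, fun w hw => ?_⟩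
  rw [norm_mul, mul_assoc]
  exact mul_le_mul (hM w hw) (hC w hw) (norm_nonneg _) ((norm_nonneg _).trans (hM w hw))

theorem IsLoopBounded.add {F G : ℂ → ℂ} (hF : IsLoopBounded δ ρ c F) (hG : IsLoopBounded δ ρ c G) :
    IsLoopBounded δ ρ c fun w => F w + G w := by
  obtain ⟨C, hC⟩ := hF.exists_bound
  obtain ⟨D, hD⟩ := hG.exists_bound
  refine ⟨hF.pos, hF.measurable.add hG.measurable, C + D, fun w hw => ?_⟩
  rw [add_mul]
  exact (norm_add_le _ _).trans (add_le_add (hC w hw) (hD w hw))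

theorem norm_cpow_le_add {z : ℂ} {μ M : ℝ} (hμ : 0 < μ) (h1 : μ ≤ ‖z‖) (h2 : ‖z‖ ≤ M) (β : ℝ) :
    ‖z ^ (β : ℂ)‖ ≤ μ ^ β + M ^ β := by
  rw [Complex.norm_cpow_real]
  rcases le_total 0 β with hβ | hβ
  · exact (Real.rpow_le_rpow (norm_nonneg _) h2 hβ).trans (by linarith [Real.rpow_nonneg hμ.le β])
  · exact (Real.rpow_le_rpow_of_nonpos hμ h1 hβ).trans
      (by linarith [Real.rpow_nonneg (hμ.le.trans (h1.trans h2)) β])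

theorem norm_cpow_sub_one_le {w : ℂ} (hρ : 0 < ρ) (hw : w ∈ loopRegion δ ρ) (β : ℝ) :
    ‖(w - 1) ^ (β : ℂ)‖ ≤ ρ ^ β + 3 ^ β :=
  norm_cpow_le_add hρ hw.2.2.2.1
    ((norm_sub_le _ _).trans (by rw [norm_one]; linarith [hw.2.1])) β

theorem isLoopBounded_cpow (hρ : 0 < ρ) (hc : 0 < c) (β : ℝ) :
    IsLoopBounded δ ρ c fun w => w ^ ((c : ℂ) - 1) * (w - 1) ^ (β : ℂ) := by
  refine ⟨hc, by fun_prop, ρ ^ β + 3 ^ β, fun w hw => ?_⟩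
  rw [norm_mul, ← Complex.ofReal_one, ← Complex.ofReal_sub, Complex.norm_cpow_real, mul_comm]
  rw [Complex.ofReal_one]
  exact mul_le_mul_of_nonneg_right (norm_cpow_sub_one_le hρ hw β) (Real.rpow_nonneg (norm_nonneg _) _)

/-- Multiplying by `conj w` makes the `y` term purely imaginary, so `‖w‖ ‖1 + iwy‖ ≥ Re w ≥ δ‖w‖`.
The bound is uniform in `y`, which is the purpose of the cone condition. -/
theorem le_norm_one_add_I_mul {w : ℂ} (hw : w ∈ loopRegion δ ρ) (y : ℝ) :
    δ ≤ ‖1 + Complex.I * w * y‖ := by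
  have hn : 0 < ‖w‖ := norm_pos_iff.2 hw.1
  have h1 := Complex.re_le_norm (starRingEnd ℂ w * (1 + Complex.I * w * y))
  have h2 : (starRingEnd ℂ w * (1 + Complex.I * w * y)).re = w.re := by
    simp
    ring
  rw [h2, norm_mul, Complex.norm_conj] at h1
  have h3 := hw.2.2.1
  nlinarith

theorem re_pos_of_mem_loopRegion (hδ : 0 < δ) {w : ℂ} (hw : w ∈ loopRegion δ ρ) : 0 < w.re :=
  (mul_pos hδ (norm_pos_iff.2 hw.1)).trans_le hw.2.2.1

theorem one_add_I_mul_mem_slitPlane {w : ℂ} (hw : 0 < w.re) (y : ℝ) :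
    1 + Complex.I * w * y ∈ Complex.slitPlane := by
  by_cases hy : y = 0
  · simp [hy]
  · refine Or.inr ?_
    simpa using ⟨hw.ne', hy⟩

theorem norm_one_add_cpow_le (hδ : 0 < δ) {w : ℂ} (hw : w ∈ loopRegion δ ρ) (y : ℝ) {a : ℝ}
    (ha : 0 ≤ a) : ‖(1 + Complex.I * w * y) ^ (-(a : ℂ))‖ ≤ δ ^ (-a) :=
  norm_cpow_neg_le hδ (le_norm_one_add_I_mul hw y) ha

theorem IsLoopPiece.hasDerivAt_integral (hδ : 0 < δ) {γ γ' : ℝ → ℂ} {s t : ℝ}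
    (hp : IsLoopPiece δ ρ γ γ' s t) {F : ℂ → ℂ} (hF : IsLoopBounded δ ρ c F) {a : ℝ} (ha : 0 < a)
    (X τ₀ : ℝ) :
    HasDerivAt (fun τ : ℝ => ∫ v in s..t,
        ((1 + Complex.I * γ v * ((τ * X : ℝ) : ℂ)) ^ (-(a : ℂ)) * F (γ v)) * γ' v)
      (∫ v in s..t, ((-(a : ℂ) * (1 + Complex.I * γ v * ((τ₀ * X : ℝ) : ℂ)) ^ (-(a : ℂ) - 1) *
        (Complex.I * γ v * X)) * F (γ v)) * γ' v) τ₀ := by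
  have hγ := hp.continuous.measurable
  have hγ' := hp.continuous_deriv.measurable
  have hFm := hF.measurable
  refine (intervalIntegral.hasDerivAt_integral_of_dominated_loc_of_deriv_le (𝕜 := ℝ)
    (F := fun (τ : ℝ) v =>
      ((1 + Complex.I * γ v * ((τ * X : ℝ) : ℂ)) ^ (-(a : ℂ)) * F (γ v)) * γ' v)
    (F' := fun (τ : ℝ) v => ((-(a : ℂ) * (1 + Complex.I * γ v * ((τ * X : ℝ) : ℂ)) ^ (-(a : ℂ) - 1) *
        (Complex.I * γ v * X)) * F (γ v)) * γ' v)
    (bound := fun v => a * δ ^ (-(a + 1)) * (2 * |X|) * ‖F (γ v) * γ' v‖) (s := Set.univ)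
    Filter.univ_mem (Filter.Eventually.of_forall fun τ => ?_) ?_ ?_ ?_ ?_ ?_).2
  · exact Measurable.aestronglyMeasurable (by fun_prop)
  · exact hp.intervalIntegrable_of_bound (hF.bounded_mul (by fun_prop)
      fun w hw => norm_one_add_cpow_le hδ hw (τ₀ * X) ha.le)
  · exact Measurable.aestronglyMeasurable (by fun_prop)
  · refine Filter.Eventually.of_forall fun v hv τ _ => ?_
    rw [Set.uIoc_of_le hp.lt.le] at hv
    have hw := hp.mem v hv
    have h1 := norm_one_add_cpow_le hδ hw (τ * X) (a := a + 1) (by linarith)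
    have h2 : -((a + 1 : ℝ) : ℂ) = -(a : ℂ) - 1 := by push_cast; ring
    rw [h2] at h1
    rw [mul_assoc _ (F (γ v)) (γ' v), norm_mul]
    refine mul_le_mul_of_nonneg_right ?_ (norm_nonneg _)
    rw [norm_mul, norm_mul, norm_mul, norm_mul, norm_neg, Complex.norm_I, one_mul,
      Complex.norm_real, Complex.norm_real, Real.norm_of_nonneg ha.le, Real.norm_eq_abs]
    have h3 := hw.2.1
    gcongr
  · exact (hp.intervalIntegrable_of_bound hF).norm.const_mul _
  · refine Filter.Eventually.of_forall fun v hv τ _ => ?_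
    rw [Set.uIoc_of_le hp.lt.le] at hv
    have hw := hp.mem v hv
    have h1 : HasDerivAt (fun τ : ℝ => 1 + Complex.I * γ v * ((τ * X : ℝ) : ℂ))
        (Complex.I * γ v * X) τ := by
      have h0 : HasDerivAt (fun τ : ℝ => ((τ * X : ℝ) : ℂ)) ((X : ℝ) : ℂ) τ := by
        simpa using ((hasDerivAt_id τ).mul_const X).ofReal_comp
      exact (h0.const_mul _).const_add _
    have h2 := HasDerivAt.comp τ
      ((hasDerivAt_id (1 + Complex.I * γ v * ((τ * X : ℝ) : ℂ))).cpow_const (c := -(a : ℂ))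
      (one_add_I_mul_mem_slitPlane (re_pos_of_mem_loopRegion hδ hw) (τ * X))) h1
    simpa [Function.comp_def] using (h2.mul_const (F (γ v))).mul_const (γ' v)

theorem IsLoop.hasDerivAt_loopIntegral (h : IsLoop δ ρ ε η) {F : ℂ → ℂ}
    (hF : IsLoopBounded δ ρ c F) {a : ℝ} (ha : 0 < a) (X τ₀ : ℝ) :
    HasDerivAt (fun τ : ℝ => loopIntegral ε η fun w =>
        (1 + Complex.I * w * ((τ * X : ℝ) : ℂ)) ^ (-(a : ℂ)) * F w)
      (loopIntegral ε η fun w => (-(a : ℂ) * (1 + Complex.I * w * ((τ₀ * X : ℝ) : ℂ)) ^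
        (-(a : ℂ) - 1) * (Complex.I * w * X)) * F w) τ₀ :=
  ((h.lower.hasDerivAt_integral h.δ_pos hF ha X τ₀).add
    (h.arc.hasDerivAt_integral h.δ_pos hF ha X τ₀)).sub
    (h.upper.hasDerivAt_integral h.δ_pos hF ha X τ₀)

/-- A loop integral vanishes if there is a primitive that is `O(|w|^c)` at the origin. -/
theorem IsLoop.loopIntegral_eq_zero (h : IsLoop δ ρ ε η) {F G : ℂ → ℂ} (hF : IsLoopBounded δ ρ c F)
    (hG : ∀ w ∈ loopRegion δ ρ, HasDerivAt G (F w) w) {C : ℝ}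
    (hC : ∀ w ∈ loopRegion δ ρ, ‖G w‖ ≤ C * ‖w‖ ^ c) : loopIntegral ε η F = 0 := by
  have hc := hF.pos
  have key : ∀ z : ℂ, IsLoopPiece δ ρ (fun s => (s : ℂ) * z) (fun _ => z) 0 1 →
      Filter.Tendsto (fun s : ℝ => G (s * z)) (nhdsWithin 0 (Set.Ioi 0)) (nhds 0) := by
    intro z hp
    have h1 : Filter.Tendsto (fun s : ℝ => C * ‖(s : ℂ) * z‖ ^ c) (nhdsWithin 0 (Set.Ioi 0))
        (nhds 0) := by
      have h2 : Continuous fun s : ℝ => C * ‖(s : ℂ) * z‖ ^ c :=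
        continuous_const.mul (Continuous.rpow_const (by fun_prop) fun s => Or.inr hc.le)
      have h3 := h2.tendsto 0
      simp only [Complex.ofReal_zero, zero_mul, norm_zero, Real.zero_rpow hc.ne', mul_zero] at h3
      exact h3.mono_left nhdsWithin_le_nhds
    refine squeeze_zero_norm' ?_ h1
    filter_upwards [Ioc_mem_nhdsGT (zero_lt_one (α := ℝ))] with s hs
    exact hC _ (hp.mem s hs)
  rw [h.loopIntegral_eq_sub hF hG (key _ h.lower) (key _ h.upper), sub_zero]

theorem cpow_eq_cpow_sub_one_mul {w : ℂ} (hw : w ≠ 0) (c : ℂ) : w ^ c = w ^ (c - 1) * w := by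
  rw [Complex.cpow_sub _ _ hw, Complex.cpow_one, div_mul_cancel₀ _ hw]

/-- The exact derivative behind both the differential equation in `X` and, at `X = 0`, the recursion
for the Beta loop integral. -/
theorem hasDerivAt_loop_primitive (hδ : 0 < δ) {w : ℂ} (hw : w ∈ loopRegion δ ρ) (a X : ℝ) :
    HasDerivAt (fun w : ℂ => w ^ (c : ℂ) * (w - 1) ^ ((a : ℂ) - c) *
        (1 + Complex.I * w * X) ^ (-(a : ℂ)))
      ((1 + Complex.I * w * X) ^ (-(a : ℂ) - 1) *
        (a * w * (1 + Complex.I * X) - c * (1 + Complex.I * w * X)) *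
        (w ^ ((c : ℂ) - 1) * (w - 1) ^ ((a : ℂ) - c - 1))) w := by
  have hre := re_pos_of_mem_loopRegion hδ hw
  have hs3 := one_add_I_mul_mem_slitPlane hre X
  have h1 := (hasDerivAt_id w).cpow_const (c := (c : ℂ)) (Or.inl hre)
  have h2 := ((hasDerivAt_id w).sub_const 1).cpow_const (c := (a : ℂ) - c) hw.2.2.2.2
  have h3 := ((((hasDerivAt_id w).const_mul Complex.I).mul_const (X : ℂ)).const_add 1).cpow_const
    (c := -(a : ℂ)) hs3
  refine ((h1.mul h2).mul h3).congr_deriv ?_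
  simp only [id, Pi.mul_apply]
  rw [cpow_eq_cpow_sub_one_mul hw.1 c,
    cpow_eq_cpow_sub_one_mul (Complex.slitPlane_ne_zero hw.2.2.2.2) ((a : ℂ) - c),
    cpow_eq_cpow_sub_one_mul (Complex.slitPlane_ne_zero hs3) (-(a : ℂ))]
  ring

/-- The loop integral of `(1 + i w X)^(-a) w^(c-1) (w-1)^(a-c-1)` is proportional to
`(1 + i X)^(-c)`. -/
theorem IsLoop.loopIntegral_cpow_mul (h : IsLoop δ ρ ε η) {a : ℝ} (ha : 0 < a) (hc : 0 < c)
    (X : ℝ) :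
    loopIntegral ε η (fun w => (1 + Complex.I * w * X) ^ (-(a : ℂ)) *
        (w ^ ((c : ℂ) - 1) * (w - 1) ^ ((a : ℂ) - c - 1))) =
      (1 + Complex.I * X) ^ (-(c : ℂ)) *
        loopIntegral ε η fun w => w ^ ((c : ℂ) - 1) * (w - 1) ^ ((a : ℂ) - c - 1) := by
  set F : ℂ → ℂ := fun w => w ^ ((c : ℂ) - 1) * (w - 1) ^ ((a : ℂ) - c - 1) with hFdef
  have hF : IsLoopBounded δ ρ c F := by
    have := isLoopBounded_cpow (δ := δ) h.ρ_pos hc (a - c - 1)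
    push_cast at this
    exact this
  set I : ℝ → ℂ := fun τ => loopIntegral ε η fun w =>
    (1 + Complex.I * w * ((τ * X : ℝ) : ℂ)) ^ (-(a : ℂ)) * F w with hI
  have hslit : ∀ τ : ℝ, 1 + Complex.I * ((τ * X : ℝ) : ℂ) ∈ Complex.slitPlane := fun τ =>
    Or.inl (by simp)
  -- This is `(1 + iτX) I' + c iX I = 0`: the combined integrand is `-iX` times the derivative of
  -- `w^c (w-1)^(a-c) (1 + iwτX)^(-a)`, which vanishes at both ends of the loop.
  have hode : ∀ τ : ℝ, (1 + Complex.I * ((τ * X : ℝ) : ℂ)) * (loopIntegral ε η fun w =>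
      (-(a : ℂ) * (1 + Complex.I * w * ((τ * X : ℝ) : ℂ)) ^ (-(a : ℂ) - 1) *
        (Complex.I * w * X)) * F w) + c * (Complex.I * X) * I τ = 0 := by
    intro τ
    have hb1 : IsLoopBounded δ ρ c fun w => (-(a : ℂ) * (1 + Complex.I * w * ((τ * X : ℝ) : ℂ)) ^
        (-(a : ℂ) - 1) * (Complex.I * w * X)) * F w := by
      refine hF.bounded_mul (by fun_prop) (M := a * δ ^ (-(a + 1)) * (2 * |X|)) fun w hw => ?_
      have h1 := norm_one_add_cpow_le h.δ_pos hw (τ * X) (a := a + 1) (by linarith)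
      have h2 : -((a + 1 : ℝ) : ℂ) = -(a : ℂ) - 1 := by push_cast; ring
      rw [h2] at h1
      rw [norm_mul, norm_mul, norm_mul, norm_mul, norm_neg, Complex.norm_I, one_mul,
        Complex.norm_real, Complex.norm_real, Real.norm_of_nonneg ha.le, Real.norm_eq_abs]
      have h3 := hw.2.1
      have h4 : 0 ≤ a * δ ^ (-(a + 1)) := mul_nonneg ha.le (Real.rpow_nonneg h.δ_pos.le _)
      gcongr
    have hb2 : IsLoopBounded δ ρ c fun w =>
        (1 + Complex.I * w * ((τ * X : ℝ) : ℂ)) ^ (-(a : ℂ)) * F w :=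
      hF.bounded_mul (by fun_prop) fun w hw => norm_one_add_cpow_le h.δ_pos hw (τ * X) ha.le
    have hcb : ∀ (k : ℂ) {G : ℂ → ℂ}, IsLoopBounded δ ρ c G → IsLoopBounded δ ρ c fun w => k * G w :=
      fun k _ hG => hG.bounded_mul measurable_const fun _ _ => le_rfl
    rw [hI, ← loopIntegral_const_mul, ← loopIntegral_const_mul,
      ← h.loopIntegral_add (hcb _ hb1) (hcb _ hb2)]
    refine h.loopIntegral_eq_zero ((hcb _ hb1).add (hcb _ hb2)) (G := fun w =>
      -(Complex.I * X) * (w ^ (c : ℂ) * (w - 1) ^ ((a : ℂ) - c) *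
        (1 + Complex.I * w * ((τ * X : ℝ) : ℂ)) ^ (-(a : ℂ)))) (fun w hw => ?_)
      (C := |X| * ((ρ ^ (a - c) + 3 ^ (a - c)) * δ ^ (-a))) (fun w hw => ?_)
    · refine ((hasDerivAt_loop_primitive h.δ_pos hw a (τ * X)).const_mul _).congr_deriv ?_
      have hre := re_pos_of_mem_loopRegion h.δ_pos hw
      rw [cpow_eq_cpow_sub_one_mul (Complex.slitPlane_ne_zero
        (one_add_I_mul_mem_slitPlane hre (τ * X))) (-(a : ℂ))]
      simp only [hFdef]
      ring
    · have h1 := norm_one_add_cpow_le h.δ_pos hw (τ * X) ha.le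
      have h2 := norm_cpow_sub_one_le h.ρ_pos hw (a - c)
      have h3 : 0 ≤ ρ ^ (a - c) := Real.rpow_nonneg h.ρ_pos.le _
      push_cast at h2
      rw [norm_mul, norm_mul, norm_mul, norm_neg, norm_mul, Complex.norm_I, one_mul,
        Complex.norm_real, Real.norm_eq_abs, Complex.norm_cpow_real]
      calc |X| * (‖w‖ ^ c * ‖(w - 1) ^ ((a : ℂ) - c)‖ *
            ‖(1 + Complex.I * w * ((τ * X : ℝ) : ℂ)) ^ (-(a : ℂ))‖)
          ≤ |X| * (‖w‖ ^ c * (ρ ^ (a - c) + 3 ^ (a - c)) * δ ^ (-a)) := by gcongr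
        _ = _ := by ring
  have hderiv : ∀ τ : ℝ, HasDerivAt
      (fun τ : ℝ => (1 + Complex.I * ((τ * X : ℝ) : ℂ)) ^ (c : ℂ) * I τ) 0 τ := by
    intro τ
    have h0 : HasDerivAt (fun τ : ℝ => 1 + Complex.I * ((τ * X : ℝ) : ℂ)) (Complex.I * X) τ := by
      have h1 : HasDerivAt (fun τ : ℝ => ((τ * X : ℝ) : ℂ)) ((X : ℝ) : ℂ) τ := by
        simpa using ((hasDerivAt_id τ).mul_const X).ofReal_comp
      exact (h1.const_mul _).const_add _
    have h1 := HasDerivAt.comp τ ((hasDerivAt_id (1 + Complex.I * ((τ * X : ℝ) : ℂ))).cpow_const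
      (c := (c : ℂ)) (hslit τ)) h0
    refine (h1.mul (h.hasDerivAt_loopIntegral hF ha X τ)).congr_deriv ?_
    simp only [Function.comp_def, id]
    rw [cpow_eq_cpow_sub_one_mul (Complex.slitPlane_ne_zero (hslit τ)) (c : ℂ)]
    linear_combination (1 + Complex.I * ((τ * X : ℝ) : ℂ)) ^ ((c : ℂ) - 1) * hode τ
  -- Since `(1 + iτX)^c I(τ)` is constant, its values at `τ = 1` and `τ = 0` agree.
  have hconst := is_const_of_deriv_eq_zero (fun τ => (hderiv τ).differentiableAt)
    (fun τ => (hderiv τ).deriv) 1 0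
  simp only [one_mul, zero_mul, Complex.ofReal_zero, mul_zero, add_zero, Complex.one_cpow, hI]
    at hconst
  have hne := Complex.slitPlane_ne_zero (hslit 1)
  rw [one_mul] at hne
  rw [← hconst, ← mul_assoc, ← Complex.cpow_add _ _ hne, neg_add_cancel, Complex.cpow_zero, one_mul]

end

/-! ### The Beta loop integral for positive exponents. -/

section

variable {δ ρ c ε η : ℝ}

/-- The integral `∫₀¹ s^(p-1) (1 + s (w - 1))^(c-1) ds`; times `(w - 1)^p` it is a primitive of
`w^(c-1) (w - 1)^(p-1)`. -/
def eulerIntegral (p c : ℝ) (w : ℂ) : ℂ :=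
  ∫ s in (0 : ℝ)..1, ((s ^ (p - 1) : ℝ) : ℂ) * (1 + s * (w - 1)) ^ ((c : ℂ) - 1)

theorem re_one_add_mul {w : ℂ} {s : ℝ} : (1 + (s : ℂ) * (w - 1)).re = 1 - s + s * w.re := by
  simp
  ring

theorem min_le_re_one_add_mul {w : ℂ} {s : ℝ} (hs0 : 0 ≤ s) (hs1 : s ≤ 1) :
    min 1 w.re ≤ (1 + (s : ℂ) * (w - 1)).re := by
  rw [re_one_add_mul]
  have h1 := min_le_left 1 w.re
  have h2 := min_le_right 1 w.re
  nlinarith [mul_le_mul_of_nonneg_left h2 hs0, mul_le_mul_of_nonneg_left h1 (sub_nonneg.2 hs1)]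

theorem norm_one_add_mul_le {w : ℂ} {s : ℝ} (hs0 : 0 ≤ s) (hs1 : s ≤ 1) :
    ‖1 + (s : ℂ) * (w - 1)‖ ≤ 2 + ‖w‖ := by
  refine (norm_add_le _ _).trans ?_
  rw [norm_one, norm_mul, Complex.norm_real, Real.norm_of_nonneg hs0]
  have h1 : ‖w - 1‖ ≤ ‖w‖ + 1 := by simpa using norm_sub_le w 1
  nlinarith [norm_nonneg (w - 1)]

theorem intervalIntegrable_rpow_mul_cpow {p : ℝ} (hp : 0 < p) {w : ℂ} (hw : 0 < w.re) (β : ℝ) :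
    IntervalIntegrable (fun s : ℝ => ((s ^ (p - 1) : ℝ) : ℂ) * (1 + s * (w - 1)) ^ (β : ℂ))
      volume 0 1 := by
  refine ((intervalIntegral.intervalIntegrable_rpow' (r := p - 1) (by linarith)).mul_const
    ((min 1 w.re) ^ β + (2 + ‖w‖) ^ β)).mono_fun (Measurable.aestronglyMeasurable (by fun_prop)) ?_
  rw [Set.uIoc_of_le zero_le_one]
  refine ae_restrict_of_forall_mem measurableSet_Ioc fun s hs => ?_
  have hs' := Real.rpow_nonneg hs.1.le (p - 1)
  simp only [norm_mul, Complex.norm_real]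
  refine mul_le_mul_of_nonneg_left (le_trans ?_ (le_abs_self _)) (norm_nonneg _)
  exact norm_cpow_le_add (lt_min one_pos hw)
    ((min_le_re_one_add_mul hs.1.le hs.2).trans (Complex.re_le_norm _))
    (norm_one_add_mul_le hs.1.le hs.2) β

theorem hasDerivAt_eulerIntegral {p : ℝ} (hp : 0 < p) (c : ℝ) {w₀ : ℂ} (hw₀ : 0 < w₀.re) :
    HasDerivAt (eulerIntegral p c) (∫ s in (0 : ℝ)..1, ((s ^ (p - 1) : ℝ) : ℂ) *
      (((c : ℂ) - 1) * (1 + s * (w₀ - 1)) ^ ((c : ℂ) - 1 - 1) * s)) w₀ := by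
  -- The radius keeps `Re w` at least `w₀.re / 2`, so `1 + s (w - 1)` stays away from `0` uniformly
  -- in `s`.
  have hball : ∀ w ∈ Metric.ball w₀ (w₀.re / 2), w₀.re / 2 ≤ w.re ∧ ‖w‖ ≤ 2 * ‖w₀‖ := by
    intro w hw
    rw [mem_ball_iff_norm] at hw
    have h1 := (abs_le.1 ((Complex.abs_re_le_norm (w - w₀)).trans hw.le)).1
    rw [Complex.sub_re] at h1
    have h2 : ‖w‖ ≤ ‖w - w₀‖ + ‖w₀‖ := by simpa using norm_add_le (w - w₀) w₀
    exact ⟨by linarith, by linarith [Complex.re_le_norm w₀]⟩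
  have hc : ((c - 1 : ℝ) : ℂ) = (c : ℂ) - 1 := by push_cast; ring
  have hc' : ((c - 1 - 1 : ℝ) : ℂ) = (c : ℂ) - 1 - 1 := by push_cast; ring
  refine (intervalIntegral.hasDerivAt_integral_of_dominated_loc_of_deriv_le (𝕜 := ℂ)
    (F := fun w s => ((s ^ (p - 1) : ℝ) : ℂ) * (1 + s * (w - 1)) ^ ((c : ℂ) - 1))
    (F' := fun w s => ((s ^ (p - 1) : ℝ) : ℂ) *
      (((c : ℂ) - 1) * (1 + s * (w - 1)) ^ ((c : ℂ) - 1 - 1) * s))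
    (bound := fun s => s ^ (p - 1) * (‖(c : ℂ) - 1‖ * ((min 1 (w₀.re / 2)) ^ (c - 1 - 1) +
      (2 + 2 * ‖w₀‖) ^ (c - 1 - 1))))
    (Metric.ball_mem_nhds w₀ (half_pos hw₀)) (Filter.Eventually.of_forall fun w => ?_)
    ?_ ?_ ?_ ?_ ?_).2
  · exact Measurable.aestronglyMeasurable (by fun_prop)
  · have := intervalIntegrable_rpow_mul_cpow hp hw₀ (c - 1)
    rwa [hc] at this
  · exact Measurable.aestronglyMeasurable (by fun_prop)
  · refine Filter.Eventually.of_forall fun s hs w hw => ?_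
    rw [Set.uIoc_of_le zero_le_one] at hs
    obtain ⟨h1, h2⟩ := hball w hw
    have h3 := norm_cpow_le_add (z := 1 + (s : ℂ) * (w - 1)) (μ := min 1 (w₀.re / 2))
      (M := 2 + 2 * ‖w₀‖) (lt_min one_pos (half_pos hw₀))
      ((min_le_min_left _ h1).trans ((min_le_re_one_add_mul hs.1.le hs.2).trans
        (Complex.re_le_norm _)))
      ((norm_one_add_mul_le hs.1.le hs.2).trans (by linarith)) (c - 1 - 1)
    rw [hc'] at h3
    rw [norm_mul, Complex.norm_real, Real.norm_of_nonneg (Real.rpow_nonneg hs.1.le _), norm_mul,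
      norm_mul, Complex.norm_real, Real.norm_of_nonneg hs.1.le]
    refine mul_le_mul_of_nonneg_left ?_ (Real.rpow_nonneg hs.1.le _)
    refine (mul_le_of_le_one_right (by positivity) hs.2).trans ?_
    exact mul_le_mul_of_nonneg_left h3 (norm_nonneg _)
  · exact (intervalIntegral.intervalIntegrable_rpow' (by linarith)).mul_const _
  · refine Filter.Eventually.of_forall fun s hs w hw => ?_
    rw [Set.uIoc_of_le zero_le_one] at hs
    have hre : 0 < w.re := (half_pos hw₀).trans_le (hball w hw).1
    have h1 : HasDerivAt (fun w : ℂ => 1 + (s : ℂ) * (w - 1)) s w := by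
      simpa using (((hasDerivAt_id w).sub_const 1).const_mul (s : ℂ)).const_add 1
    exact (h1.cpow_const (Or.inl ((lt_min one_pos hre).trans_le
      (min_le_re_one_add_mul hs.1.le hs.2)))).const_mul _

/-- The sum of the two integrands is the `s`-derivative of `s^p (1 + s (w - 1))^(c-1)`, which is `0`
at `s = 0` because `p > 0`. -/
theorem eulerIntegral_ode {p : ℝ} (hp : 0 < p) (c : ℝ) {w : ℂ} (hw : 0 < w.re) :
    p * eulerIntegral p c w + (w - 1) * (∫ s in (0 : ℝ)..1, ((s ^ (p - 1) : ℝ) : ℂ) *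
      (((c : ℂ) - 1) * (1 + s * (w - 1)) ^ ((c : ℂ) - 1 - 1) * s)) = w ^ ((c : ℂ) - 1) := by
  have hslit : ∀ s : ℝ, 0 ≤ s → s ≤ 1 → 1 + (s : ℂ) * (w - 1) ∈ Complex.slitPlane := fun s h0 h1 =>
    Or.inl ((lt_min one_pos hw).trans_le (min_le_re_one_add_mul h0 h1))
  have hc : ((c - 1 : ℝ) : ℂ) = (c : ℂ) - 1 := by push_cast; ring
  have hc' : ((c - 1 - 1 : ℝ) : ℂ) = (c : ℂ) - 1 - 1 := by push_cast; ring
  have hi1 := (intervalIntegrable_rpow_mul_cpow hp hw (c - 1)).const_mul (p : ℂ)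
  have hi2 : IntervalIntegrable (fun s : ℝ => (w - 1) * (((s ^ (p - 1) : ℝ) : ℂ) *
      (((c : ℂ) - 1) * (1 + s * (w - 1)) ^ ((c : ℂ) - 1 - 1) * s))) volume 0 1 := by
    have h := (intervalIntegrable_rpow_mul_cpow hp hw (c - 1 - 1)).mul_continuousOn
      (g := fun s : ℝ => (w - 1) * (((c : ℂ) - 1) * s)) (Continuous.continuousOn (by fun_prop))
    rw [hc'] at h
    refine h.congr fun s _ => ?_
    ring
  rw [hc] at hi1
  rw [eulerIntegral, ← intervalIntegral.integral_const_mul, ← intervalIntegral.integral_const_mul,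
    ← intervalIntegral.integral_add hi1 hi2]
  have hftc := intervalIntegral.integral_eq_sub_of_hasDerivAt_of_le zero_le_one
    (f := fun s : ℝ => ((s ^ p : ℝ) : ℂ) * (1 + s * (w - 1)) ^ ((c : ℂ) - 1))
    (f' := fun s : ℝ => (p : ℂ) * (((s ^ (p - 1) : ℝ) : ℂ) * (1 + s * (w - 1)) ^ ((c : ℂ) - 1)) +
      (w - 1) * (((s ^ (p - 1) : ℝ) : ℂ) *
      (((c : ℂ) - 1) * (1 + s * (w - 1)) ^ ((c : ℂ) - 1 - 1) * s))) ?_ ?_ (hi1.add hi2)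
  · rw [hftc]
    simp [Real.zero_rpow hp.ne']
  · intro s hs
    refine ContinuousAt.continuousWithinAt (ContinuousAt.mul ?_ ?_)
    · exact Complex.continuous_ofReal.continuousAt.comp
        (Real.continuousAt_rpow_const _ _ (Or.inr hp.le))
    · exact ContinuousAt.comp (f := fun s : ℝ => 1 + (s : ℂ) * (w - 1))
        (g := fun z : ℂ => z ^ ((c : ℂ) - 1)) (continuousAt_cpow_const (hslit s hs.1 hs.2))
        (Continuous.continuousAt (by fun_prop))
  · intro s hs
    have h1 : HasDerivAt (fun s : ℝ => ((s ^ p : ℝ) : ℂ)) ((p * s ^ (p - 1) : ℝ) : ℂ) s :=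
      (Real.hasDerivAt_rpow_const (Or.inl hs.1.ne')).ofReal_comp
    have h2 : HasDerivAt (fun s : ℝ => 1 + (s : ℂ) * (w - 1)) (w - 1) s := by
      simpa using (((hasDerivAt_id s).ofReal_comp).mul_const (w - 1)).const_add 1
    have h3 := HasDerivAt.comp s ((hasDerivAt_id (1 + (s : ℂ) * (w - 1))).cpow_const
      (c := (c : ℂ) - 1) (hslit s hs.1.le hs.2.le)) h2
    refine (h1.mul h3).congr_deriv ?_
    have h4 : s ^ p = s ^ (p - 1) * s := by
      rw [← Real.rpow_add_one hs.1.ne', sub_add_cancel]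
    simp only [Function.comp_def, id, h4]
    push_cast
    ring

theorem hasDerivAt_cpow_mul_eulerIntegral {p : ℝ} (hp : 0 < p) (c : ℝ) {w : ℂ} (hw : 0 < w.re)
    (hw1 : w - 1 ∈ Complex.slitPlane) :
    HasDerivAt (fun w => (w - 1) ^ (p : ℂ) * eulerIntegral p c w)
      (w ^ ((c : ℂ) - 1) * (w - 1) ^ ((p : ℂ) - 1)) w := by
  have h1 := ((hasDerivAt_id w).sub_const 1).cpow_const (c := (p : ℂ)) hw1
  refine (h1.mul (hasDerivAt_eulerIntegral hp c hw)).congr_deriv ?_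
  simp only [id]
  rw [cpow_eq_cpow_sub_one_mul (Complex.slitPlane_ne_zero hw1) (p : ℂ),
    ← eulerIntegral_ode hp c hw]
  ring

/-- At `τ = 0` the integrand is that of the Beta function. When `c < 1` domination is delicate near
`s = 1`, where `Re (1 + s (τz - 1)) ≥ 1 - s` supplies the Beta integrand itself as majorant; the
term with `3` serves `c ≥ 1`. -/
theorem tendsto_eulerIntegral {p : ℝ} (hp : 0 < p) (hc : 0 < c) {z : ℂ} (hz : 0 < z.re)
    (hz2 : ‖z‖ ≤ 2) :
    Filter.Tendsto (fun τ : ℝ => eulerIntegral p c (τ * z)) (nhdsWithin 0 (Set.Ioi 0))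
      (nhds (Complex.betaIntegral p c)) := by
  have hbeta := Complex.betaIntegral_convergent (u := (p : ℂ)) (v := (c : ℂ)) (by simpa) (by simpa)
  have hae : ∀ᵐ s : ℝ, s ≠ 1 := Measure.ae_ne volume 1
  refine intervalIntegral.tendsto_integral_filter_of_dominated_convergence
    (fun s => ‖(s : ℂ) ^ ((p : ℂ) - 1) * (1 - s) ^ ((c : ℂ) - 1)‖ + s ^ (p - 1) * 3 ^ (c - 1))
    (Filter.Eventually.of_forall fun τ => Measurable.aestronglyMeasurable (by fun_prop)) ?_
    (hbeta.norm.add ((intervalIntegral.intervalIntegrable_rpow' (by linarith)).mul_const _)) ?_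
  · filter_upwards [Ioc_mem_nhdsGT (zero_lt_one (α := ℝ))] with τ hτ
    filter_upwards [hae] with s hs1 hs
    rw [Set.uIoc_of_le zero_le_one] at hs
    have hs1' : 0 < 1 - s := sub_pos.2 (lt_of_le_of_ne hs.2 hs1)
    have hlow : 1 - s ≤ ‖1 + (s : ℂ) * (τ * z - 1)‖ := by
      refine le_trans ?_ (Complex.re_le_norm _)
      rw [re_one_add_mul, Complex.re_ofReal_mul]
      have := mul_pos hs.1 (mul_pos hτ.1 hz)
      linarith
    have hup : ‖1 + (s : ℂ) * (τ * z - 1)‖ ≤ 3 := by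
      have h1 : 1 + (s : ℂ) * (τ * z - 1) = ((1 - s : ℝ) : ℂ) + (s : ℂ) * (τ * z) := by
        push_cast; ring
      rw [h1]
      refine (norm_add_le _ _).trans ?_
      rw [norm_mul, norm_mul, Complex.norm_real, Complex.norm_real, Complex.norm_real,
        Real.norm_of_nonneg hs1'.le, Real.norm_of_nonneg hs.1.le, Real.norm_of_nonneg hτ.1.le]
      have h2 : τ * ‖z‖ ≤ 2 := by nlinarith [norm_nonneg z, hτ.2, hτ.1]
      nlinarith [hs.1, hs.2]
    have h3 := norm_cpow_le_add hs1' hlow hup (c - 1)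
    have h4 : ((c - 1 : ℝ) : ℂ) = (c : ℂ) - 1 := by push_cast; ring
    have h5 : ((p - 1 : ℝ) : ℂ) = (p : ℂ) - 1 := by push_cast; ring
    have h6 : ((1 - s : ℝ) : ℂ) = 1 - (s : ℂ) := by push_cast; ring
    rw [h4] at h3
    have h7 : ‖(s : ℂ) ^ ((p : ℂ) - 1) * (1 - s) ^ ((c : ℂ) - 1)‖ =
        s ^ (p - 1) * (1 - s) ^ (c - 1) := by
      rw [← h4, ← h5, ← h6, norm_mul, Complex.norm_cpow_real, Complex.norm_cpow_real,
        Complex.norm_real, Complex.norm_real, Real.norm_of_nonneg hs.1.le,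
        Real.norm_of_nonneg hs1'.le]
    rw [h7, norm_mul, Complex.norm_real, Real.norm_of_nonneg (Real.rpow_nonneg hs.1.le _),
      ← mul_add]
    exact mul_le_mul_of_nonneg_left h3 (Real.rpow_nonneg hs.1.le _)
  · filter_upwards [hae] with s hs1 hs
    rw [Set.uIoc_of_le zero_le_one] at hs
    have hs1' : 0 < 1 - s := sub_pos.2 (lt_of_le_of_ne hs.2 hs1)
    rw [Complex.ofReal_cpow hs.1.le]
    push_cast
    refine Filter.Tendsto.const_mul _ ?_
    have h1 : ContinuousAt (fun τ : ℝ => (1 + (s : ℂ) * (τ * z - 1)) ^ ((c : ℂ) - 1)) 0 := by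
      refine ContinuousAt.comp (f := fun τ : ℝ => 1 + (s : ℂ) * (τ * z - 1))
        (g := fun z : ℂ => z ^ ((c : ℂ) - 1)) (continuousAt_cpow_const (Or.inl ?_))
        (Continuous.continuousAt (by fun_prop))
      simpa using sub_pos.1 hs1'
    have h2 := h1.tendsto.mono_left (nhdsWithin_le_nhds (s := Set.Ioi (0 : ℝ)))
    have h3 : 1 + (s : ℂ) * (((0 : ℝ) : ℂ) * z - 1) = 1 - s := by push_cast; ring
    rwa [h3] at h2

theorem tendsto_mul_sub_one_nhdsWithin {z : ℂ} {S : Set ℂ} (hS : ∀ s : ℝ, 0 < s → s * z - 1 ∈ S) :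
    Filter.Tendsto (fun s : ℝ => (s : ℂ) * z - 1) (nhdsWithin 0 (Set.Ioi 0))
      (nhdsWithin (-1) S) := by
  refine tendsto_nhdsWithin_iff.2 ⟨?_, ?_⟩
  · have h : Continuous fun s : ℝ => (s : ℂ) * z - 1 := by fun_prop
    have := h.tendsto 0
    simp only [Complex.ofReal_zero, zero_mul, zero_sub] at this
    exact this.mono_left nhdsWithin_le_nhds
  · filter_upwards [self_mem_nhdsWithin] with s hs using hS s hs

/-- Serves at `-1`, on the branch cut, where the power is discontinuous but the logarithm has
one-sided limits. -/
theorem tendsto_cpow_of_tendsto_log {f : ℝ → ℂ} {l : Filter ℝ} {L p : ℂ} (hf : ∀ᶠ s in l, f s ≠ 0)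
    (h : Filter.Tendsto (fun s => Complex.log (f s)) l (nhds L)) :
    Filter.Tendsto (fun s => f s ^ p) l (nhds (Complex.exp (L * p))) := by
  refine ((Complex.continuous_exp.tendsto _).comp (h.mul_const p)).congr' ?_
  filter_upwards [hf] with s hs
  rw [Function.comp, Complex.cpow_def_of_ne_zero hs]

/-- The primitive `(w - 1)^p * eulerIntegral p c w` has different limits at the two ends: `w - 1`
approaches `-1` from below, then from above the cut, giving `e^(-iπp)` and `e^(iπp)` times the Beta
function. -/
theorem IsLoop.loopIntegral_cpow_of_pos (h : IsLoop δ ρ ε η) {p : ℝ} (hp : 0 < p) (hc : 0 < c) :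
    loopIntegral ε η (fun w => w ^ ((c : ℂ) - 1) * (w - 1) ^ ((p : ℂ) - 1)) =
      2 * Complex.I * Complex.sin (Real.pi * p) * Complex.betaIntegral p c := by
  have hF : IsLoopBounded δ ρ c fun w => w ^ ((c : ℂ) - 1) * (w - 1) ^ ((p : ℂ) - 1) := by
    have := isLoopBounded_cpow (δ := δ) h.ρ_pos hc (p - 1)
    push_cast at this
    exact this
  have hne : ∀ z : ℂ, z.im ≠ 0 → ∀ᶠ s : ℝ in nhdsWithin 0 (Set.Ioi 0), (s : ℂ) * z - 1 ≠ 0 := by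
    intro z hz
    filter_upwards [self_mem_nhdsWithin] with s hs h0
    have := congrArg Complex.im h0
    simp only [Complex.sub_im, Complex.im_ofReal_mul, Complex.one_im, Complex.zero_im, sub_zero,
      mul_eq_zero] at this
    exact this.elim (ne_of_gt hs) hz
  have hlow : Filter.Tendsto (fun s : ℝ => Complex.log (s * circleMap 1 ε (-(Real.pi - η)) - 1))
      (nhdsWithin 0 (Set.Ioi 0)) (nhds (-(Real.pi * Complex.I))) := by
    have h1 := Complex.tendsto_log_nhdsWithin_im_neg_of_re_neg_of_im_zero (z := -1)
      (by simp) (by simp)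
    have h2 := h1.comp (tendsto_mul_sub_one_nhdsWithin
      (z := circleMap 1 ε (-(Real.pi - η))) fun s hs => by
        simpa using mul_neg_of_pos_of_neg hs h.lower_im)
    simpa [Function.comp_def] using h2
  have hup : Filter.Tendsto (fun s : ℝ => Complex.log (s * circleMap 1 ε (Real.pi - η) - 1))
      (nhdsWithin 0 (Set.Ioi 0)) (nhds (Real.pi * Complex.I)) := by
    have h1 := Complex.tendsto_log_nhdsWithin_im_nonneg_of_re_neg_of_im_zero (z := -1)
      (by simp) (by simp)
    have h2 := h1.comp (tendsto_mul_sub_one_nhdsWithin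
      (z := circleMap 1 ε (Real.pi - η)) fun s hs => by
        simpa using (mul_pos hs h.upper_im).le)
    simpa [Function.comp_def] using h2
  have key := h.loopIntegral_eq_sub hF (fun w hw => hasDerivAt_cpow_mul_eulerIntegral hp c
    (re_pos_of_mem_loopRegion h.δ_pos hw) hw.2.2.2.2)
    ((tendsto_cpow_of_tendsto_log (hne _ h.lower_im.ne) hlow).mul (tendsto_eulerIntegral hp hc
      (re_pos_of_mem_loopRegion h.δ_pos h.lower_mem) h.lower_mem.2.1))
    ((tendsto_cpow_of_tendsto_log (hne _ h.upper_im.ne') hup).mul (tendsto_eulerIntegral hp hc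
      (re_pos_of_mem_loopRegion h.δ_pos h.upper_mem) h.upper_mem.2.1))
  rw [key, Complex.sin]
  have e1 : Complex.exp ((Real.pi : ℂ) * Complex.I * p) =
      Complex.exp ((Real.pi : ℂ) * p * Complex.I) := by congr 1; ring
  have e2 : Complex.exp (-((Real.pi : ℂ) * Complex.I) * p) =
      Complex.exp (-((Real.pi : ℂ) * p) * Complex.I) := by congr 1; ring
  rw [e1, e2]
  linear_combination (Complex.exp ((Real.pi : ℂ) * p * Complex.I) -
    Complex.exp (-((Real.pi : ℂ) * p) * Complex.I)) * Complex.betaIntegral p c * Complex.I_mul_I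

end

/-! ### The Beta loop integral for nonpositive exponents, and Fubini along the loop. -/

section

variable {δ ρ c ε η : ℝ}

theorem IsLoopPiece.tendsto_integral_cpow (hρ : 0 < ρ) (hc : 0 < c) {γ γ' : ℝ → ℂ} {s t : ℝ}
    (hp : IsLoopPiece δ ρ γ γ' s t) :
    Filter.Tendsto (fun p : ℝ => ∫ v in s..t,
        γ v ^ ((c : ℂ) - 1) * (γ v - 1) ^ ((p : ℂ) - 1) * γ' v) (nhdsWithin 0 (Set.Ioi 0))
      (nhds (∫ v in s..t, γ v ^ ((c : ℂ) - 1) * (γ v - 1) ^ (((0 : ℝ) : ℂ) - 1) * γ' v)) := by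
  have hγ := hp.continuous.measurable
  have hγ' := hp.continuous_deriv.measurable
  refine intervalIntegral.tendsto_integral_filter_of_dominated_convergence
    -- For `0 < p ≤ 1` and `ρ ≤ ‖w - 1‖ ≤ 3` one has `‖w - 1‖^p ≤ 3`.
    (fun v => (3 / ρ) * (‖γ v‖ ^ (c - 1) * ‖γ' v‖))
    (Filter.Eventually.of_forall fun p => Measurable.aestronglyMeasurable (by fun_prop)) ?_
    ((hp.integrable c hc).const_mul _) ?_
  · filter_upwards [Ioc_mem_nhdsGT (zero_lt_one (α := ℝ))] with p hp1
    refine Filter.Eventually.of_forall fun v hv => ?_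
    rw [Set.uIoc_of_le hp.lt.le] at hv
    have hw := hp.mem v hv
    have h3 : ‖γ v - 1‖ ≤ 3 := (norm_sub_le _ _).trans (by rw [norm_one]; linarith [hw.2.1])
    have hn : 0 < ‖γ v - 1‖ := hρ.trans_le hw.2.2.2.1
    have h4 : ‖γ v - 1‖ ^ p ≤ 3 := by
      refine (Real.rpow_le_rpow hn.le h3 hp1.1.le).trans ?_
      calc (3 : ℝ) ^ p ≤ 3 ^ (1 : ℝ) :=
            Real.rpow_le_rpow_of_exponent_le (by norm_num) hp1.2
        _ = 3 := Real.rpow_one 3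
    have h5 : ‖(γ v - 1) ^ ((p : ℂ) - 1)‖ ≤ 3 / ρ := by
      rw [← Complex.ofReal_one, ← Complex.ofReal_sub, Complex.norm_cpow_real, Complex.ofReal_one,
        Real.rpow_sub_one hn.ne']
      exact div_le_div₀ (by norm_num) h4 hρ hw.2.2.2.1
    have h6 : ‖γ v ^ ((c : ℂ) - 1)‖ = ‖γ v‖ ^ (c - 1) := by
      rw [← Complex.norm_cpow_real]
      push_cast
      rfl
    rw [norm_mul, norm_mul, h6, mul_comm (‖γ v‖ ^ (c - 1)), mul_assoc]
    exact mul_le_mul_of_nonneg_right h5 (by positivity)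
  · refine Filter.Eventually.of_forall fun v hv => ?_
    rw [Set.uIoc_of_le hp.lt.le] at hv
    have hne := Complex.slitPlane_ne_zero (hp.mem v hv).2.2.2.2
    refine Filter.Tendsto.mul_const _ (Filter.Tendsto.const_mul _ ?_)
    have h1 : Continuous fun p : ℝ => (γ v - 1) ^ ((p : ℂ) - 1) :=
      (Continuous.const_cpow (by fun_prop) (Or.inl hne))
    exact (h1.tendsto 0).mono_left nhdsWithin_le_nhds

theorem IsLoop.tendsto_loopIntegral_cpow (h : IsLoop δ ρ ε η) (hc : 0 < c) :
    Filter.Tendsto (fun p : ℝ => loopIntegral ε η fun w =>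
        w ^ ((c : ℂ) - 1) * (w - 1) ^ ((p : ℂ) - 1)) (nhdsWithin 0 (Set.Ioi 0))
      (nhds (loopIntegral ε η fun w => w ^ ((c : ℂ) - 1) * (w - 1) ^ (((0 : ℝ) : ℂ) - 1))) :=
  ((h.lower.tendsto_integral_cpow h.ρ_pos hc).add (h.arc.tendsto_integral_cpow h.ρ_pos hc)).sub
    (h.upper.tendsto_integral_cpow h.ρ_pos hc)

/-- The reflection formula replaces `sin (πp) Γ(p)` by `π / Γ(1 - p)`, which removes the singular
factor at `p = 0`. -/
theorem IsLoop.loopIntegral_cpow_of_mem_Ioo (h : IsLoop δ ρ ε η) (hc : 0 < c) {p : ℝ} (hp : 0 < p)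
    (hp1 : p < 1) :
    loopIntegral ε η (fun w => w ^ ((c : ℂ) - 1) * (w - 1) ^ ((p : ℂ) - 1)) =
      2 * Real.pi * Complex.I * Complex.Gamma c * (Complex.Gamma (1 - p))⁻¹ *
        (Complex.Gamma (c + p))⁻¹ := by
  rw [h.loopIntegral_cpow_of_pos hp hc]
  have hsin : Complex.sin (Real.pi * p) ≠ 0 := by
    have : 0 < Real.sin (Real.pi * p) :=
      Real.sin_pos_of_pos_of_lt_pi (mul_pos Real.pi_pos hp) (by nlinarith [Real.pi_pos])
    exact_mod_cast this.ne'
  have h1 := Complex.Gamma_mul_Gamma_one_sub (p : ℂ)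
  have h2 := Complex.Gamma_mul_Gamma_eq_betaIntegral (s := (p : ℂ)) (t := (c : ℂ)) (by simpa)
    (by simpa)
  have h3 : Complex.Gamma (c + p) ≠ 0 :=
    Complex.Gamma_ne_zero_of_re_pos (by simpa using add_pos hc hp)
  have h4 : Complex.Gamma (1 - p) ≠ 0 := Complex.Gamma_ne_zero_of_re_pos (by simpa using hp1)
  rw [add_comm] at h2
  rw [eq_div_iff hsin] at h1
  field_simp
  linear_combination (-Complex.sin (Real.pi * p) * Complex.Gamma (1 - p)) * h2 +
    Complex.Gamma c * h1

/-- The primitive above needs `p > 0`, so the value at `0` is a limit from the right; `1/Γ` is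
entire. -/
theorem IsLoop.loopIntegral_cpow_zero (h : IsLoop δ ρ ε η) (hc : 0 < c) :
    loopIntegral ε η (fun w => w ^ ((c : ℂ) - 1) * (w - 1) ^ (((0 : ℝ) : ℂ) - 1)) =
      2 * Real.pi * Complex.I * Complex.Gamma c * (Complex.Gamma (1 - (0 : ℝ)))⁻¹ *
        (Complex.Gamma (c + (0 : ℝ)))⁻¹ := by
  have hinv : Continuous fun z : ℂ => (Complex.Gamma z)⁻¹ :=
    Complex.differentiable_one_div_Gamma.continuous
  have hcont : Continuous fun p : ℝ => 2 * Real.pi * Complex.I * Complex.Gamma c *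
      (Complex.Gamma (1 - p))⁻¹ * (Complex.Gamma (c + p))⁻¹ :=
    (continuous_const.mul (hinv.comp (f := fun p : ℝ => 1 - (p : ℂ)) (by fun_prop))).mul
      (hinv.comp (f := fun p : ℝ => (c : ℂ) + p) (by fun_prop))
  refine tendsto_nhds_unique (h.tendsto_loopIntegral_cpow hc) ?_
  refine ((hcont.tendsto 0).mono_left nhdsWithin_le_nhds).congr' ?_
  filter_upwards [Ioo_mem_nhdsGT (zero_lt_one (α := ℝ))] with p hp
  exact (h.loopIntegral_cpow_of_mem_Ioo hc hp.1 hp.2).symm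

/-- The integrand is the derivative of `w^c (w-1)^p`, which is `O(|w|^c)` at the origin. -/
theorem IsLoop.loopIntegral_cpow_recursion (h : IsLoop δ ρ ε η) (hc : 0 < c) (p : ℝ) :
    (c + p) * loopIntegral ε η (fun w => w ^ ((c : ℂ) - 1) * (w - 1) ^ (((p + 1 : ℝ) : ℂ) - 1)) +
      p * loopIntegral ε η (fun w => w ^ ((c : ℂ) - 1) * (w - 1) ^ ((p : ℂ) - 1)) = 0 := by
  have hb : ∀ q : ℝ, IsLoopBounded δ ρ c fun w => w ^ ((c : ℂ) - 1) * (w - 1) ^ ((q : ℂ) - 1) := by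
    intro q
    have := isLoopBounded_cpow (δ := δ) h.ρ_pos hc (q - 1)
    push_cast at this
    exact this
  have hcb : ∀ (k : ℂ) {G : ℂ → ℂ}, IsLoopBounded δ ρ c G → IsLoopBounded δ ρ c fun w => k * G w :=
    fun k _ hG => hG.bounded_mul measurable_const fun _ _ => le_rfl
  rw [← loopIntegral_const_mul, ← loopIntegral_const_mul,
    ← h.loopIntegral_add (hcb _ (hb _)) (hcb _ (hb _))]
  refine h.loopIntegral_eq_zero ((hcb _ (hb _)).add (hcb _ (hb _)))
    (G := fun w => w ^ (c : ℂ) * (w - 1) ^ (p : ℂ)) (C := ρ ^ p + 3 ^ p) (fun w hw => ?_)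
    (fun w hw => ?_)
  · have h1 := hasDerivAt_loop_primitive (c := c) h.δ_pos hw (c + p) 0
    simp only [Complex.ofReal_zero, mul_zero, add_zero, Complex.one_cpow, mul_one, one_mul,
      Complex.ofReal_add, add_sub_cancel_left] at h1
    refine h1.congr_deriv ?_
    have h2 : ((p + 1 : ℝ) : ℂ) - 1 = p := by push_cast; ring
    rw [h2, cpow_eq_cpow_sub_one_mul (Complex.slitPlane_ne_zero hw.2.2.2.2) (p : ℂ)]
    ring
  · rw [norm_mul, Complex.norm_cpow_real, mul_comm]
    exact mul_le_mul_of_nonneg_right (norm_cpow_sub_one_le h.ρ_pos hw p)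
      (Real.rpow_nonneg (norm_nonneg _) _)

/-- The Beta integral along the loop. -/
theorem IsLoop.loopIntegral_cpow (h : IsLoop δ ρ ε η) (hc : 0 < c) {p : ℝ} (hp1 : p < 1)
    (hcp : 0 < c + p) :
    loopIntegral ε η (fun w => w ^ ((c : ℂ) - 1) * (w - 1) ^ ((p : ℂ) - 1)) =
      2 * Real.pi * Complex.I * Complex.Gamma c * (Complex.Gamma (1 - p))⁻¹ *
        (Complex.Gamma (c + p))⁻¹ := by
  -- The induction descends from `p + 1` to `p` by the recursion, where division by `p` is allowed
  -- as only `p < 0` remains; `c + p > 0` keeps the Gamma factors nonzero.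
  obtain ⟨n, hn⟩ := exists_nat_ge (-p)
  induction n generalizing p with
  | zero =>
    rcases (show 0 ≤ p by simpa using hn).eq_or_lt with rfl | hp
    · exact h.loopIntegral_cpow_zero hc
    · exact h.loopIntegral_cpow_of_mem_Ioo hc hp hp1
  | succ n ih =>
    rcases le_or_gt 0 p with hp | hp
    · exact ih hp1 hcp (by linarith [(Nat.cast_nonneg n : (0 : ℝ) ≤ n)])
    have h1 := ih (p := p + 1) (by linarith) (by linarith) (by push_cast at hn; linarith)
    have h2 := h.loopIntegral_cpow_recursion hc p
    rw [h1] at h2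
    have hp0 : (p : ℂ) ≠ 0 := by exact_mod_cast hp.ne
    have hcp0 : (c : ℂ) + p ≠ 0 := by exact_mod_cast hcp.ne'
    have e1 : (1 : ℂ) - ((p + 1 : ℝ) : ℂ) = -p := by push_cast; ring
    have e2 : (c : ℂ) + ((p + 1 : ℝ) : ℂ) = (c + p) + 1 := by push_cast; ring
    have e3 : (1 : ℂ) - p = -p + 1 := by ring
    rw [e1, e2, Complex.Gamma_add_one _ hcp0] at h2
    rw [e3, Complex.Gamma_add_one _ (neg_ne_zero.2 hp0)]
    have hG : Complex.Gamma (-p) ≠ 0 := Complex.Gamma_ne_zero_of_re_pos (by simpa using hp)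
    have hG2 : Complex.Gamma (c + p) ≠ 0 := Complex.Gamma_ne_zero_of_re_pos (by simpa using hcp)
    rw [← mul_right_inj' hp0]
    refine (eq_neg_of_add_eq_zero_right h2).trans ?_
    field_simp

theorem IsLoopPiece.integrable_prod {E : Type*} [MeasurableSpace E] {P : Measure E}
    [IsFiniteMeasure P] (hδ : 0 < δ) {γ γ' : ℝ → ℂ} {s t : ℝ} (hp : IsLoopPiece δ ρ γ γ' s t)
    {F : ℂ → ℂ} (hF : IsLoopBounded δ ρ c F) {a : ℝ} (ha : 0 ≤ a) {Y : E → ℝ} (hY : Measurable Y) :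
    Integrable (fun q : E × ℝ => ((1 + Complex.I * γ q.2 * (Y q.1 : ℂ)) ^ (-(a : ℂ)) * F (γ q.2)) *
      γ' q.2) (P.prod (volume.restrict (Set.Ioc s t))) := by
  have hγ := hp.continuous.measurable
  have hγ' := hp.continuous_deriv.measurable
  have hFm := hF.measurable
  have h1 : Integrable (fun v => F (γ v) * γ' v) (volume.restrict (Set.Ioc s t)) :=
    (intervalIntegrable_iff_integrableOn_Ioc_of_le hp.lt.le).1 (hp.intervalIntegrable_of_bound hF)
  refine ((h1.norm.comp_snd P).const_mul (δ ^ (-a))).mono'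
    (Measurable.aestronglyMeasurable (by fun_prop)) ?_
  have h2 : ∀ᵐ q ∂(P.prod (volume.restrict (Set.Ioc s t))), q.2 ∈ Set.Ioc s t := by
    refine Measure.quasiMeasurePreserving_snd.ae ?_
    exact ae_restrict_mem measurableSet_Ioc
  filter_upwards [h2] with q hq
  rw [mul_assoc, norm_mul]
  exact mul_le_mul_of_nonneg_right (norm_one_add_cpow_le hδ (hp.mem _ hq) _ ha) (norm_nonneg _)

/-- Fubini's theorem for the loop integral. -/
theorem IsLoop.integral_loopIntegral {E : Type*} [MeasurableSpace E] {P : Measure E}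
    [IsFiniteMeasure P] (h : IsLoop δ ρ ε η) {F : ℂ → ℂ} (hF : IsLoopBounded δ ρ c F) {a : ℝ}
    (ha : 0 ≤ a) {Y : E → ℝ} (hY : Measurable Y) :
    ∫ e, (loopIntegral ε η fun w => (1 + Complex.I * w * (Y e : ℂ)) ^ (-(a : ℂ)) * F w) ∂P =
      loopIntegral ε η fun w => (∫ e, (1 + Complex.I * w * (Y e : ℂ)) ^ (-(a : ℂ)) ∂P) * F w := by
  have key : ∀ {γ γ' : ℝ → ℂ} {s t : ℝ}, IsLoopPiece δ ρ γ γ' s t →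
      Integrable (fun e => ∫ v in s..t,
        ((1 + Complex.I * γ v * (Y e : ℂ)) ^ (-(a : ℂ)) * F (γ v)) * γ' v) P ∧
      ∫ e, (∫ v in s..t, ((1 + Complex.I * γ v * (Y e : ℂ)) ^ (-(a : ℂ)) * F (γ v)) * γ' v) ∂P =
        ∫ v in s..t, ((∫ e, (1 + Complex.I * γ v * (Y e : ℂ)) ^ (-(a : ℂ)) ∂P) * F (γ v)) *
          γ' v := by
    intro γ γ' s t hp
    have hI := hp.integrable_prod h.δ_pos hF ha hY (P := P)
    simp only [intervalIntegral.integral_of_le hp.lt.le]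
    refine ⟨hI.integral_prod_left, ?_⟩
    rw [integral_integral_swap hI]
    simp only [integral_mul_const]
  obtain ⟨i1, k1⟩ := key h.lower
  obtain ⟨i2, k2⟩ := key h.arc
  obtain ⟨i3, k3⟩ := key h.upper
  simp only [loopIntegral, segmentIntegral]
  exact (integral_sub (i1.add i2) i3).trans
    (congrArg₂ (· - ·) ((integral_add i1 i2).trans (congrArg₂ (· + ·) k1 k2)) k3)

end

/-! ### Passing to the law of the means and changing the exponent. -/

section

/-- Follows from `1 + |x + y| ≤ (1 + |x|)(1 + |y|)` and `1 + |xy| ≤ (1 + |x|)(1 + |y|)`; it makes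
`⟨t, f⟩` log-integrable. -/
theorem log_one_add_abs_sum_le {ι : Type*} (s : Finset ι) (t x : ι → ℝ) :
    Real.log (1 + |∑ j ∈ s, t j * x j|) ≤
      ∑ j ∈ s, (Real.log (1 + |t j|) + Real.log (1 + |x j|)) := by
  classical
  induction s using Finset.induction_on with
  | empty => simp
  | insert j s hj ih =>
    rw [Finset.sum_insert hj, Finset.sum_insert hj]
    refine le_trans ?_ (add_le_add (log_one_add_mul_le (abs_nonneg (t j)) (abs_nonneg (x j))) ih)
    rw [← abs_mul, ← Real.log_mul (by positivity) (by positivity)]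
    refine Real.log_le_log (by positivity) ?_
    nlinarith [abs_add_le (t j * x j) (∑ j ∈ s, t j * x j), abs_nonneg (t j * x j),
      abs_nonneg (∑ j ∈ s, t j * x j),
      mul_nonneg (abs_nonneg (t j * x j)) (abs_nonneg (∑ j ∈ s, t j * x j))]

theorem integrable_log_one_add_abs_sum {Ω ι : Type*} [MeasurableSpace Ω] {α : Measure Ω}
    [IsFiniteMeasure α] [Fintype ι] {f : ι → Ω → ℝ} (hf : ∀ k, Measurable (f k))
    (hlog : ∀ k, Integrable (fun x => Real.log (1 + |f k x|)) α) (t : ι → ℝ) :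
    Integrable (fun x => Real.log (1 + |∑ j, t j * f j x|)) α := by
  refine Integrable.mono' (integrable_finsetSum Finset.univ fun j _ =>
    (integrable_const (Real.log (1 + |t j|))).add (hlog j))
    (Measurable.aestronglyMeasurable (by fun_prop)) (Filter.Eventually.of_forall fun x => ?_)
  rw [Real.norm_of_nonneg (Real.log_nonneg (by linarith [abs_nonneg (∑ j, t j * f j x)]))]
  exact log_one_add_abs_sum_le Finset.univ t fun j => f j x

theorem isProbabilityMeasure_betaDist {a c : ℝ} (hc : 0 < c) (hca : c ≤ a) :
    IsProbabilityMeasure (betaDist c (a - c)) := by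
  rw [betaDist]
  split_ifs with h
  · infer_instance
  · exact isProbabilityMeasureBeta hc (lt_of_le_of_ne (sub_nonneg.2 hca) (Ne.symm h))

/-- The Markov–Krein identity is available for `Re w > 0` only, so the point `u = 0` must be null.
-/
theorem ae_pos_betaDist (p q : ℝ) : ∀ᵐ u ∂(betaDist p q), 0 < u := by
  rw [betaDist]
  split_ifs with h
  · rw [ae_dirac_iff measurableSet_Ioi]
    exact one_pos
  · have hm : Measurable (betaPDF p q) :=
      ENNReal.measurable_ofReal.comp (measurable_betaPDFReal _ _)
    rw [betaMeasure, ae_withDensity_iff hm]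
    refine Filter.Eventually.of_forall fun u hu => ?_
    by_contra h0
    exact hu (betaPDF_eq_zero_of_nonpos (not_lt.1 h0))

variable {Ω E : Type*} [MeasurableSpace Ω] [MeasurableSpace E] {α : Measure Ω} {P : Measure E}
  {m : E → ProbabilityMeasure Ω}

theorem IsDirichletProcess.integral_vectorMeanLaw (hm : IsDirichletProcess α P m) {d : ℕ}
    {f : Fin d → Ω → ℝ} (hf : ∀ k, Measurable (f k))
    (hint : ∀ᵐ e ∂P, ∀ k, Integrable (f k) (m e : Measure Ω)) (t : Fin d → ℝ) (c : ℝ) :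
    ∫ x, 1 / (1 + Complex.I * ((∑ j, t j * x j : ℝ) : ℂ)) ^ (c : ℂ) ∂(vectorMeanLaw P m f) =
      ∫ e, (1 + Complex.I * ((∫ y, ∑ j, t j * f j y ∂(m e : Measure Ω) : ℝ) : ℂ)) ^ (-(c : ℂ))
        ∂P := by
  have hmeas : Measurable fun e k => ∫ x, f k x ∂(m e : Measure Ω) :=
    measurable_pi_iff.2 fun k => hm.measurable_integral (hf k).stronglyMeasurable
  rw [vectorMeanLaw, integral_map hmeas.aemeasurable (Measurable.aestronglyMeasurable (by fun_prop))]
  refine integral_congr_ae ?_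
  filter_upwards [hint] with e he
  rw [integral_finsetSum _ fun j _ => (he j).const_mul (t j), one_div, ← Complex.cpow_neg]
  simp only [integral_const_mul]

/-- The Beta mixture is taken at `z = iY`. As `Re (1 + iuY) = 1`, the integrand is bounded by `1`
and Fubini applies. -/
theorem integral_cpow_eq_integral_betaDist [IsFiniteMeasure P] {a c : ℝ} (hc : 0 < c) (hca : c ≤ a)
    {Y : E → ℝ} (hY : Measurable Y) :
    ∫ e, (1 + Complex.I * (Y e : ℂ)) ^ (-(c : ℂ)) ∂P =
      ∫ u : ℝ, ∫ e, (1 + Complex.I * u * (Y e : ℂ)) ^ (-(a : ℂ)) ∂P ∂(betaDist c (a - c)) := by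
  have := isProbabilityMeasure_betaDist hc hca
  have h1 : ∀ e, (1 + Complex.I * (Y e : ℂ)) ^ (-(c : ℂ)) =
      ∫ u : ℝ, (1 + Complex.I * u * (Y e : ℂ)) ^ (-(a : ℂ)) ∂(betaDist c (a - c)) := fun e => by
    rw [← integral_betaDist_cpow hc hca (by simp)]
    simp only [mul_assoc, mul_left_comm Complex.I]
  simp only [h1]
  refine integral_integral_swap (Integrable.of_bound (Measurable.aestronglyMeasurable ?_) 1
    (Filter.Eventually.of_forall fun q => ?_))
  · unfold Function.uncurry
    fun_prop
  · refine (norm_cpow_neg_le one_pos (le_trans ?_ (Complex.re_le_norm _))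
      (hc.le.trans hca)).trans (Real.one_rpow _).le
    simp

theorem IsDirichletProcess.integral_cpow_of_le [IsFiniteMeasure α] [IsProbabilityMeasure P]
    (hm : IsDirichletProcess α P m) (hα : α ≠ 0) {g : Ω → ℝ} (hg : Measurable g)
    (hlog : Integrable (fun x => Real.log (1 + |g x|)) α) {c : ℝ} (hc : 0 < c)
    (hca : c ≤ α.real Set.univ) :
    ∫ e, (1 + Complex.I * ((∫ y, g y ∂(m e : Measure Ω) : ℝ) : ℂ)) ^ (-(c : ℂ)) ∂P =
      ∫ u, expNegLogIntegral α g (u : ℂ) ∂(betaDist c (α.real Set.univ - c)) := by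
  set a : ℝ := α.real Set.univ
  have hY : Measurable fun e => ∫ y, g y ∂(m e : Measure Ω) :=
    hm.measurable_integral hg.stronglyMeasurable
  rw [integral_cpow_eq_integral_betaDist hc hca hY]
  refine integral_congr_ae ?_
  filter_upwards [ae_pos_betaDist c (a - c)] with u hu
  exact hm.integral_cpow_one_add_I_mul hα hg hlog (by simpa using hu)

theorem IsDirichletProcess.integral_cpow_of_lt [IsFiniteMeasure α] [IsProbabilityMeasure P]
    (hm : IsDirichletProcess α P m) (hα : 0 < α.real Set.univ) {g : Ω → ℝ} (hg : Measurable g)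
    (hlog : Integrable (fun x => Real.log (1 + |g x|)) α) {c : ℝ} (hac : α.real Set.univ < c)
    {ε η : ℝ} (hε : 0 < ε) (hε1 : ε < 1) (hη : 0 < η) (hηπ : η < Real.pi) :
    ∫ e, (1 + Complex.I * ((∫ y, g y ∂(m e : Measure Ω) : ℝ) : ℂ)) ^ (-(c : ℂ)) ∂P =
      ((Real.Gamma (c - α.real Set.univ + 1) * Real.Gamma (α.real Set.univ) : ℝ) : ℂ) /
          (2 * (Real.pi : ℂ) * Complex.I * (Real.Gamma c : ℂ)) *
        loopIntegral ε η fun w => expNegLogIntegral α g w * w ^ ((c : ℂ) - 1) *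
          (w - 1) ^ ((α.real Set.univ : ℂ) - (c : ℂ) - 1) := by
  have hα0 : α ≠ 0 := fun h => by simp [h] at hα
  set a : ℝ := α.real Set.univ
  have hc : 0 < c := hα.trans hac
  obtain ⟨δ, ρ, h⟩ := exists_isLoop hε hε1 hη hηπ
  have hY : Measurable fun e => ∫ y, g y ∂(m e : Measure Ω) :=
    hm.measurable_integral hg.stronglyMeasurable
  have hF : IsLoopBounded δ ρ c fun w =>
      w ^ ((c : ℂ) - 1) * (w - 1) ^ ((a : ℂ) - c - 1) := by
    have := isLoopBounded_cpow (δ := δ) h.ρ_pos hc (a - c - 1)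
    push_cast at this
    exact this
  have h1 : (loopIntegral ε η fun w => expNegLogIntegral α g w * w ^ ((c : ℂ) - 1) *
      (w - 1) ^ ((a : ℂ) - (c : ℂ) - 1)) = loopIntegral ε η fun w =>
        (∫ e, (1 + Complex.I * w * ((∫ y, g y ∂(m e : Measure Ω) : ℝ) : ℂ)) ^ (-(a : ℂ)) ∂P) *
          (w ^ ((c : ℂ) - 1) * (w - 1) ^ ((a : ℂ) - c - 1)) :=
    h.loopIntegral_congr fun w hw => by
      rw [hm.integral_cpow_one_add_I_mul hα0 hg hlog (re_pos_of_mem_loopRegion h.δ_pos hw),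
        mul_assoc]
  -- With `p = a - c` the Gamma arguments `1 - p` and `c + p` become `c - a + 1` and `a`: the value
  -- is the inverse of the prefactor.
  have hJ := h.loopIntegral_cpow hc (p := a - c) (by linarith) (by linarith)
  have e1 : ((a - c : ℝ) : ℂ) - 1 = (a : ℂ) - c - 1 := by push_cast; ring
  have e2 : (1 : ℂ) - ((a - c : ℝ) : ℂ) = ((c - a + 1 : ℝ) : ℂ) := by push_cast; ring
  have e3 : (c : ℂ) + ((a - c : ℝ) : ℂ) = (a : ℂ) := by push_cast; ring
  rw [e1, e2, e3, Complex.Gamma_ofReal, Complex.Gamma_ofReal, Complex.Gamma_ofReal] at hJ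
  rw [h1, ← h.integral_loopIntegral hF hα.le hY]
  simp only [h.loopIntegral_cpow_mul hα hc]
  rw [integral_mul_const, hJ]
  have g1 : (Real.Gamma c : ℂ) ≠ 0 := by exact_mod_cast (Real.Gamma_pos_of_pos hc).ne'
  have g2 : (Real.Gamma a : ℂ) ≠ 0 := by exact_mod_cast (Real.Gamma_pos_of_pos hα).ne'
  have g3 : (Real.Gamma (c - a + 1) : ℂ) ≠ 0 := by
    exact_mod_cast (Real.Gamma_pos_of_pos (by linarith)).ne'
  have g4 : (Real.pi : ℂ) ≠ 0 := by exact_mod_cast Real.pi_ne_zero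
  have g5 := Complex.I_ne_zero
  push_cast at g3 ⊢
  field_simp

end

end

theorem mainTheorem12 {Ω E : Type*} [MeasurableSpace Ω] [MeasurableSpace E]
    (α : Measure Ω) [IsFiniteMeasure α] (a : ℝ) (ha : a = α.real Set.univ) (ha0 : 0 < a)
    (P : Measure E) [IsProbabilityMeasure P]
    (m : E → ProbabilityMeasure Ω) (hm : IsDirichletProcess α P m)
    {d : ℕ} (f : Fin d → Ω → ℝ) (hf : ∀ k, Measurable (f k))
    (hlog : ∀ k, Integrable (fun x => Real.log (1 + |f k x|)) α) :
    (∀ᵐ e ∂P, ∀ k, Integrable (f k) (m e : Measure Ω)) ∧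
    ∀ (t : Fin d → ℝ) (c : ℝ), 0 < c →
      (c ≤ a →
        ∫ x, 1 / (1 + Complex.I * ((∑ j, t j * x j : ℝ) : ℂ)) ^ (c : ℂ) ∂(vectorMeanLaw P m f) =
          ∫ u, expNegLogIntegral α (fun y => ∑ j, t j * f j y) (u : ℂ) ∂(betaDist c (a - c))) ∧
      (a < c → ∀ ε η : ℝ, 0 < ε → ε < 1 → 0 < η → η < Real.pi →
        ∫ x, 1 / (1 + Complex.I * ((∑ j, t j * x j : ℝ) : ℂ)) ^ (c : ℂ) ∂(vectorMeanLaw P m f) =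
          ((Real.Gamma (c - a + 1) * Real.Gamma a : ℝ) : ℂ) /
              (2 * (Real.pi : ℂ) * Complex.I * (Real.Gamma c : ℂ)) *
            loopIntegral ε η fun w =>
              expNegLogIntegral α (fun y => ∑ j, t j * f j y) w *
                w ^ ((c : ℂ) - 1) * (w - 1) ^ ((a : ℂ) - (c : ℂ) - 1)) := by
  have hα : α ≠ 0 := fun h => by simp [ha, h] at ha0
  have hint : ∀ᵐ e ∂P, ∀ k, Integrable (f k) (m e : Measure Ω) :=
    ae_all_iff.2 fun k => hm.ae_integrable hα (hf k) (hlog k)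
  subst ha
  refine ⟨hint, fun t c hc => ?_⟩
  have hg : Measurable fun y => ∑ j, t j * f j y := by fun_prop
  have hglog := integrable_log_one_add_abs_sum hf hlog t
  rw [hm.integral_vectorMeanLaw hf hint]
  exact ⟨fun hca => hm.integral_cpow_of_le hα hg hglog hc hca,
    fun hac ε η hε hε1 hη hηπ => hm.integral_cpow_of_lt ha0 hg hglog hac hε hε1 hη hηπ⟩
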